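/- A configuration $(G,x)$ is a finite connected simple graph $G$ together with a binary string $x(v)\in\{0,1\}^*$ at every node $v$. A distributed language is a decidable collection ${\cal L}$ of configurations. A prefix of $(G,x)$ is a configuration $(G[U],x[U])$ with $U\subseteq V(G)$ (so $G[U]$ is connected), and ${\cal L}$ is hereditary if every prefix of every member of ${\cal L}$ is in ${\cal L}$. An identity assignment $\mathrm{Id}$ for $G$ gives pairwise distinct integers to the nodes. We consider synchronous distributed algorithms in the ${\cal LOCAL}$ model: initially a node knows only its identity and its input; in each round it exchanges messages of unrestricted size with its neighbours and performs a (computable, always halting) local computation; in a randomized algorithm each node may moreover toss finitely many independent fair coins in its initial computation and in every round, their number being bounded in terms of the node's current information. Every node eventually outputs "yes" or "no" (and continues to relay messages afterwards). Let $t$ be a real-valued function of triplets $(G,x,\mathrm{Id})$ that is non-decreasing, i.e. $t(G',x',\mathrm{Id}')\le t(G,x,\mathrm{Id})$ whenever $G'$ is a connected induced subgraph of $G$ and $x',\mathrm{Id}'$ are the restrictions of $x,\mathrm{Id}$ to it. An algorithm runs in time $t$ if for every $(G,x,\mathrm{Id})$, and all coin tosses, every node has output after at most $t(G,x,\mathrm{Id})$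 rounds; the nodes need not know $t$. - $\mathrm{LD}(t)$ is the class of all distributed languages ${\cal L}$ for which there is a deterministic algorithm running in time $t$ such that, for all $(G,x)$ and all $\mathrm{Id}$: if $(G,x)\in{\cal L}$ then every node outputs "yes", and if $(G,x)\notin{\cal L}$ then at least one node outputs "no". Moreover $\mathrm{LD}(O(t))=\bigcup_{c>1}\mathrm{LD}(c\cdot t)$. - $\mathrm{BPLD}(t,p,q)$ is the class of all distributed languages ${\cal L}$ for which there is a randomized algorithm running in time $t$ such that, for all $(G,x)$ and all $\mathrm{Id}$: if $(G,x)\in{\cal L}$ then all nodes output "yes" with probability at least $p$, and if $(G,x)\notin{\cal L}$ then at least one node outputs "no" with probability at least $q$. **Theorem.** Let ${\cal L}$ be a hereditary distributed language and let $t$ be a non-decreasing function of triplets $(G,x,\mathrm{Id})$. If ${\cal L}\in\mathrm{BPLD}(t,p,q)$ for constants $p,q\in(0,1]$ such that $p^2+q>1$, then ${\cal L}\in\mathrm{LD}(O(t))$. -/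

import Mathlib

namespace LocalDecision

/-! ### Configurations, identities, languages -/

/-- A configuration `(G, x)`: a finite connected (in particular nonempty) simple graph, whose
nodes are numbered for definiteness, with a binary string at every node. -/
structure Config where
  n : ℕ
  graph : SimpleGraph (Fin n)
  connected : graph.Connected
  input : Fin n → List Bool

/-- A triplet `(G, x, Id)`: a configuration together with pairwise distinct integer identities. -/
structure IdConfig extends Config where
  ident : Fin n → ℤ
  ident_injective : Function.Injective ident

/-- `c'` is (isomorphic to) a prefix of `c`, i.e. to `(G[U], x[U])` for some set `U` of nodes of
`c`; as `c'` is a configuration, `G[U]` is connected. -/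
def IsPrefix (c' c : Config) : Prop :=
  ∃ φ : c'.graph ↪g c.graph, ∀ v, c'.input v = c.input (φ v)

open Classical in
/-- The finite data describing a configuration: the list of the inputs and the adjacency matrix. -/
noncomputable def Config.code (c : Config) : List (List Bool) × List (List Bool) :=
  (List.ofFn c.input, List.ofFn fun u => List.ofFn fun v => decide (c.graph.Adj u v))

/-- A distributed language: a decidable collection of configurations. -/
structure DistributedLanguage where
  carrier : Set Config
  decidable : ∃ f : List (List Bool) × List (List Bool) → Bool,
    Computable f ∧ ∀ c : Config, f c.code = true ↔ c ∈ carrier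

/-- Every prefix of a configuration of the language is in the language. (The choice `U = V` shows
that such a language is closed under isomorphism.) -/
def DistributedLanguage.Hereditary (L : DistributedLanguage) : Prop :=
  ∀ c ∈ L.carrier, ∀ c' : Config, IsPrefix c' c → c' ∈ L.carrier

/-- Non-decreasing functions of triplets: passing to a connected induced subgraph, with the
restricted inputs and identities, does not increase the value. -/
def NonDecreasing (t : IdConfig → ℝ) : Prop :=
  ∀ I' I : IdConfig, ∀ φ : I'.graph ↪g I.graph,
    (∀ v, I'.input v = I.input (φ v)) → (∀ v, I'.ident v = I.ident (φ v)) → t I' ≤ t I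

/-! ### Algorithms in the LOCAL model -/

/-- A (randomized) distributed algorithm in the synchronous LOCAL model. The memory of a node and
its messages, of unrestricted size, are coded by natural numbers, and all local computations are
computable functions.

Before the first round, a node knows its identity and its input only; it tosses `initCoins` random
bits and computes its first memory state by `init`. In every round it sends the message
`send state` to all its neighbours (a message meant for one neighbour is a broadcast that names
its addressee), receives the messages of its neighbours, each with the identity of its sender,
tosses `stepCoins` random bits and computes its next state by `step`. The node has an output as
soon as `out state` is not `none`; `some true` is "yes", `some false` is "no". -/
structure LocalAlgorithm where
  initCoins : ℤ × List Bool → ℕ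
  init : (ℤ × List Bool) × List Bool → ℕ
  send : ℕ → ℕ
  stepCoins : ℕ × List (ℤ × ℕ) → ℕ
  step : (ℕ × List (ℤ × ℕ)) × List Bool → ℕ
  out : ℕ → Option Bool
  computable_initCoins : Computable initCoins
  computable_init : Computable init
  computable_send : Computable send
  computable_stepCoins : Computable stepCoins
  computable_step : Computable step
  computable_out : Computable out

/-- The outcomes of all coin tosses: `ω (v, r, i)` is the `i`-th random bit that is available to
node `v` in round `r`. -/
abbrev CoinSpace (n : ℕ) : Type := Fin n × ℕ × ℕ → Bool

/-- Independent fair coins. -/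
noncomputable def coinMeasure (n : ℕ) : MeasureTheory.Measure (CoinSpace n) :=
  MeasureTheory.Measure.infinitePi fun _ => (PMF.uniformOfFintype Bool).toMeasure

/-- The string of the `k` random bits tossed by node `v` in round `r`. -/
def coins {n : ℕ} (ω : CoinSpace n) (v : Fin n) (r k : ℕ) : List Bool :=
  List.ofFn fun i : Fin k => ω (v, r, i)

namespace LocalAlgorithm

variable (A : LocalAlgorithm) (I : IdConfig)

open Classical in
/-- What `v` receives when the memory states are given by `s`: the messages of its neighbours,
labelled by the identities of their senders, and listed in increasing order of these. -/
noncomputable def inbox (s : Fin I.n → ℕ) (v : Fin I.n) : List (ℤ × ℕ) :=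
  (((List.finRange I.n).filter fun u => decide (I.graph.Adj v u)).map
    fun u => (I.ident u, A.send (s u))).insertionSort fun a b => a.1 ≤ b.1

/-- The memory state of every node after `r` rounds. A node that has an output keeps taking part
in the communication. -/
noncomputable def state (ω : CoinSpace I.n) : ℕ → Fin I.n → ℕ
  | 0, v =>
      A.init ((I.ident v, I.input v), coins ω v 0 (A.initCoins (I.ident v, I.input v)))
  | r + 1, v =>
      A.step ((state ω r v, A.inbox I (state ω r) v),
        coins ω v (r + 1) (A.stepCoins (state ω r v, A.inbox I (state ω r) v)))

/-- `v` outputs `b`: this is its first, hence irrevocable, output. -/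
def Outputs (ω : CoinSpace I.n) (v : Fin I.n) (b : Bool) : Prop :=
  ∃ r, A.out (A.state I ω r v) = some b ∧ ∀ s < r, A.out (A.state I ω s v) = none

/-- In every execution, every node has an output after at most `t(G, x, Id)` rounds. -/
def RunsInTime (t : IdConfig → ℝ) : Prop :=
  ∀ (I : IdConfig) (ω : CoinSpace I.n) (v : Fin I.n),
    ∃ r : ℕ, (r : ℝ) ≤ t I ∧ (A.out (A.state I ω r v)).isSome

/-- No coins are tossed. -/
def Deterministic : Prop :=
  (∀ a, A.initCoins a = 0) ∧ ∀ a, A.stepCoins a = 0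

/-- The (deterministic) algorithm `A` decides `L`. -/
def Decides (L : DistributedLanguage) : Prop :=
  ∀ (I : IdConfig) (ω : CoinSpace I.n),
    (I.toConfig ∈ L.carrier → ∀ v, A.Outputs I ω v true) ∧
    (I.toConfig ∉ L.carrier → ∃ v, A.Outputs I ω v false)

/-- `A` is a `(p, q)`-decider for `L` (termination is part of `RunsInTime`). -/
def IsDecider (p q : ℝ) (L : DistributedLanguage) : Prop :=
  ∀ I : IdConfig,
    (I.toConfig ∈ L.carrier →
      ENNReal.ofReal p ≤ coinMeasure I.n {ω | ∀ v, A.Outputs I ω v true}) ∧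
    (I.toConfig ∉ L.carrier →
      ENNReal.ofReal q ≤ coinMeasure I.n {ω | ∃ v, A.Outputs I ω v false})

end LocalAlgorithm

/-! ### The classes -/

/-- `LD(t)`: languages decided by a deterministic distributed algorithm in at most `t` rounds. -/
def LD (t : IdConfig → ℝ) : Set DistributedLanguage :=
  {L | ∃ A : LocalAlgorithm, A.Deterministic ∧ A.RunsInTime t ∧ A.Decides L}

/-- `LD(O(t))`, the union of the classes `LD(c * t)` over the constants `c > 1`. -/
def LDBigO (t : IdConfig → ℝ) : Set DistributedLanguage :=
  {L | ∃ c : ℝ, 1 < c ∧ L ∈ LD fun I => c * t I}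

/-- `BPLD(t, p, q)`: languages with a randomized `(p, q)`-decider running in at most `t` rounds. -/
def BPLD (t : IdConfig → ℝ) (p q : ℝ) : Set DistributedLanguage :=
  {L | ∃ A : LocalAlgorithm, A.RunsInTime t ∧ A.IsDecider p q L}

end LocalDecision

/-! The deterministic algorithm lets every node collect its surroundings in the whole graph. Since
`t` is unknown to the nodes, a node `v` simulates the randomized algorithm `A` on every induced
subgraph of the collected ball that contains `v`, under all coin tosses. It stops at a round `r` for
which `v` always has an output there within `r / C` rounds, and then says whether its ball, of
radius `r - 1`, belongs to the language. Monotonicity of `t` forces this by round `C * ⌊t I⌋₊`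
(`runsInTime_collector`). Heredity makes every node say "yes" on members.

Conversely, suppose that all nodes say "yes" although the graph is not in the language
(`accepts_of_forall_ball`). Take a minimal connected set `S` inducing a non-member, let `T` be the
worst running time of `A` on `S`, and let `w ∈ S` be a slowest node. The ball accepted by `w` has
radius at least `4κT`, so `S` reaches farther than that from `w`. Let `v` be a node of `S` farthest
from `w`. Then `S \ {v}` is connected, and the ball of radius `4κT` around `v` in `S` misses `w`; by
minimality both induce members.

Cut `S` by distance from `v` (`sq_sub_le_allYes`). Among `κ` slices of width `2T`, pairwise too
distant to share coins, one is unanimous for "yes" with probability at least `1 - δ`: otherwise, by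
independence, all of them would be with probability at most `(1 - δ) ^ κ < p`, whereas they behave
as in the member `S \ {v}`. The nodes before that slice behave as in the ball around `v`, those
behind it as in `S \ {v}`, and the two sides are independent. So `S` is unanimous with probability
at least `p ^ 2 - δ > 1 - q`, contradicting the guarantee for non-members.

Executions on all induced subgraphs are driven by the coins of the ambient graph (`stateOn`), so
that they can be compared pointwise. The rest of the work is the computability of the simulation. -/

namespace Computable

/-! ### Computability of list operations and of the order on the integers -/

variable {α β σ : Type*} [Primcodable α] [Primcodable β] [Primcodable σ]

theorem list_foldl {f : α → List β} {g : α → σ} {h : α → σ × β → σ} (hf : Computable f)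
    (hg : Computable g) (hh : Computable₂ h) :
    Computable fun a => (f a).foldl (fun s b => h a (s, b)) (g a) := by
  -- Recursion on the number of entries consumed; past the end the accumulator is kept, in
  -- accordance with `take`.
  have key : Computable fun a => (Nat.rec (g a) (fun i s =>
      (Option.casesOn (f a)[i]? s fun b => h a (s, b) : σ)) (f a).length : σ) := by
    refine Computable.nat_rec (h := fun a (p : ℕ × σ) =>
      (Option.casesOn (f a)[p.1]? p.2 fun b => h a (p.2, b) : σ))
      (Computable.list_length.comp hf) hg ?_
    refine Computable.option_casesOn (o := fun p : α × ℕ × σ => (f p.1)[p.2.1]?)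
      (Computable.list_getElem?.comp (hf.comp Computable.fst)
        (Computable.fst.comp Computable.snd)) (Computable.snd.comp Computable.snd) ?_
    exact hh.comp (Computable.fst.comp Computable.fst)
      ((Computable.snd.comp (Computable.snd.comp Computable.fst)).pair Computable.snd)
  refine key.of_eq fun a => ?_
  have aux : ∀ k, (Nat.rec (g a) (fun i s =>
      (Option.casesOn (f a)[i]? s fun b => h a (s, b) : σ)) k : σ) =
      ((f a).take k).foldl (fun s b => h a (s, b)) (g a) := by
    intro k
    induction k with
    | zero => simp
    | succ k ih =>
      rw [List.take_add_one, List.foldl_append, ← ih]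
      dsimp only
      cases (f a)[k]? <;> rfl
  rw [aux, List.take_length]

theorem list_foldr {f : α → List β} {g : α → σ} {h : α → β × σ → σ} (hf : Computable f)
    (hg : Computable g) (hh : Computable₂ h) :
    Computable fun a => (f a).foldr (fun b s => h a (b, s)) (g a) := by
  refine (list_foldl (h := fun a (p : σ × β) => h a (p.2, p.1)) (Computable.list_reverse.comp hf)
    hg ?_).of_eq fun a => by rw [List.foldl_reverse]
  exact hh.comp Computable.fst
    ((Computable.snd.comp Computable.snd).pair (Computable.fst.comp Computable.snd))

theorem list_map {f : α → List β} {g : α → β → σ} (hf : Computable f) (hg : Computable₂ g) :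
    Computable fun a => (f a).map (g a) := by
  refine (list_foldr (h := fun a (p : β × List σ) => g a p.1 :: p.2) hf (Computable.const []) ?_).of_eq
    fun a => by induction f a <;> simp_all
  exact Computable.list_cons.comp (hg.comp Computable.fst (Computable.fst.comp Computable.snd))
    (Computable.snd.comp Computable.snd)

theorem list_flatMap {f : α → List β} {g : α → β → List σ} (hf : Computable f)
    (hg : Computable₂ g) : Computable fun a => (f a).flatMap (g a) := by
  refine (list_foldr (h := fun a (p : β × List σ) => g a p.1 ++ p.2) hf (Computable.const []) ?_).of_eq
    fun a => by induction f a <;> simp_all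
  exact Computable.list_append.comp (hg.comp Computable.fst (Computable.fst.comp Computable.snd))
    (Computable.snd.comp Computable.snd)

theorem list_filter {f : α → List β} {g : α → β → Bool} (hf : Computable f)
    (hg : Computable₂ g) : Computable fun a => (f a).filter (g a) := by
  refine (list_flatMap (g := fun a b => bif g a b then [b] else []) hf ?_).of_eq fun a => ?_
  · exact Computable.cond hg (Computable.list_cons.comp Computable.snd (Computable.const []))
      (Computable.const [])
  · induction f a with
    | nil => rfl
    | cons b l ih => cases hb : g a b <;> simp_all

theorem list_any {f : α → List β} {g : α → β → Bool} (hf : Computable f)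
    (hg : Computable₂ g) : Computable fun a => (f a).any (g a) := by
  refine (list_foldr (h := fun a (p : β × Bool) => g a p.1 || p.2) hf
    (Computable.const false) ?_).of_eq fun a => by induction f a <;> simp_all
  exact (Primrec.or.to_comp).comp (hg.comp Computable.fst (Computable.fst.comp Computable.snd))
    (Computable.snd.comp Computable.snd)

theorem list_all {f : α → List β} {g : α → β → Bool} (hf : Computable f)
    (hg : Computable₂ g) : Computable fun a => (f a).all (g a) := by
  refine (list_foldr (h := fun a (p : β × Bool) => g a p.1 && p.2) hf
    (Computable.const true) ?_).of_eq fun a => by induction f a <;> simp_all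
  exact (Primrec.and.to_comp).comp (hg.comp Computable.fst (Computable.fst.comp Computable.snd))
    (Computable.snd.comp Computable.snd)

theorem list_sublists' {f : α → List β} (hf : Computable f) :
    Computable fun a => (f a).sublists' := by
  refine (list_foldr (h := fun _ (p : β × List (List β)) => p.2 ++ p.2.map (List.cons p.1)) hf
    (Computable.const [[]]) ?_).of_eq fun a => by induction f a <;> simp_all
  exact Computable.list_append.comp (Computable.snd.comp Computable.snd)
    (list_map (Computable.snd.comp Computable.snd) (Computable.list_cons.comp
      (Computable.fst.comp (Computable.snd.comp Computable.fst)) Computable.snd))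

theorem list_sections {f : α → List (List β)} (hf : Computable f) :
    Computable fun a => (f a).sections := by
  refine (list_foldr (h := fun _ (p : List β × List (List β)) =>
    p.2.flatMap fun s => p.1.map fun b => b :: s) hf
    (Computable.const [[]]) ?_).of_eq fun a => by
      induction f a with
      | nil => rfl
      | cons x l ih => rw [List.foldr_cons, ih]; rfl
  refine list_flatMap (Computable.snd.comp Computable.snd) (list_map
    (Computable.fst.comp (Computable.snd.comp Computable.fst)) (Computable.list_cons.comp
      Computable.snd (Computable.snd.comp Computable.fst)))

end Computable

theorem Primrec.int_lt : Primrec₂ fun a b : ℤ => decide (a < b) := by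
  have e : Primrec (Encodable.encode : ℤ → ℕ) := Primrec.encode
  have par : Primrec fun n : ℕ => decide (n % 2 = 0) :=
    (Primrec.eq.decide.comp (Primrec.nat_mod.comp .id (.const 2)) (.const 0))
  have lt : Primrec₂ fun m n : ℕ => decide (m < n) := Primrec.nat_lt.decide
  have ea := e.comp (Primrec.fst (α := ℤ) (β := ℤ))
  have eb := e.comp (Primrec.snd (α := ℤ) (β := ℤ))
  refine (Primrec.cond (par.comp ea)
    (Primrec.cond (par.comp eb) (lt.comp ea eb) (.const false))
    (Primrec.cond (par.comp eb) (.const true) (lt.comp eb ea))).of_eq ?_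
  -- The encoding interleaves the signs: parity gives the sign, and codes of negative integers are
  -- in reverse order.
  have h0 : ∀ n : ℕ, Encodable.encode (Int.ofNat n) = 2 * n := fun n => rfl
  have h1 : ∀ n : ℕ, Encodable.encode (Int.negSucc n) = 2 * n + 1 := fun n => rfl
  rintro ⟨a | a, b | b⟩ <;> simp only [h0, h1] <;>
    simp [Bool.cond_eq_ite, Nat.add_mod, Int.negSucc_eq] <;> omega

theorem Primrec.list_contains {α : Type*} [Primcodable α] [DecidableEq α] :
    Primrec₂ fun (l : List α) (a : α) => decide (a ∈ l) := by
  refine (Primrec.list_foldr (h := fun p (b : α × Bool) => (p.2 == b.1) || b.2) Primrec.fst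
    (.const false) ?_).of_eq fun p => ?_
  · exact Primrec.or.comp (Primrec.beq.comp (Primrec.snd.comp Primrec.fst)
      (Primrec.fst.comp Primrec.snd)) (Primrec.snd.comp Primrec.snd)
  · obtain ⟨l, a⟩ := p
    induction l with
    | nil => simp
    | cons b l ih => simp_all [Bool.beq_eq_decide_eq]

/-! ### Restrictions of a configuration to sets of nodes -/

namespace LocalDecision

theorem eq_of_perm_of_pairwise_fst {α : Type*} {l₁ l₂ : List (ℤ × α)} (h : l₁.Perm l₂)
    (h₁ : l₁.Pairwise fun a b => a.1 ≤ b.1) (h₂ : l₂.Pairwise fun a b => a.1 < b.1) :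
    l₁ = l₂ := by
  refine List.Perm.eq_of_pairwise (le := fun a b => a.1 ≤ b.1) ?_ h₁
    (h₂.imp fun h => h.le) h
  intro a b ha hb hab hba
  have ha' := h.mem_iff.1 ha
  have hn : (l₂.map Prod.fst).Nodup := (List.pairwise_map.2 h₂).imp fun h => h.ne
  exact List.inj_on_of_nodup_map hn ha' hb (le_antisymm hab hba)

namespace IdConfig

variable (I : IdConfig)

/-- The nodes in the order of their identities. -/
noncomputable def nodes : List (Fin I.n) :=
  (List.finRange I.n).insertionSort fun a b => I.ident a ≤ I.ident b

theorem mem_nodes (v : Fin I.n) : v ∈ I.nodes := by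
  simp [nodes]

theorem nodes_nodup : I.nodes.Nodup :=
  (List.perm_insertionSort _ _).nodup_iff.2 (List.nodup_finRange _)

theorem pairwise_nodes : I.nodes.Pairwise fun a b => I.ident a < I.ident b := by
  have : Std.Total fun a b : Fin I.n => I.ident a ≤ I.ident b := ⟨fun a b => le_total _ _⟩
  have : IsTrans (Fin I.n) fun a b : Fin I.n => I.ident a ≤ I.ident b :=
    ⟨fun a b c => le_trans⟩
  have h := List.pairwise_insertionSort (fun a b : Fin I.n => I.ident a ≤ I.ident b)
    (List.finRange I.n)
  exact (h.and (List.nodup_iff_pairwise_ne.1 I.nodes_nodup)).imp fun h =>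
    lt_of_le_of_ne h.1 fun e => h.2 (I.ident_injective e)

open Classical in
/-- The nodes of `S` in the order of their identities. -/
noncomputable def nodesIn (S : Set (Fin I.n)) : List (Fin I.n) :=
  I.nodes.filter fun v => decide (v ∈ S)

theorem mem_nodesIn {S : Set (Fin I.n)} {v : Fin I.n} : v ∈ I.nodesIn S ↔ v ∈ S := by
  simp [nodesIn, mem_nodes]

theorem pairwise_nodesIn (S : Set (Fin I.n)) :
    (I.nodesIn S).Pairwise fun a b => I.ident a < I.ident b :=
  I.pairwise_nodes.filter _

theorem nodesIn_nodup (S : Set (Fin I.n)) : (I.nodesIn S).Nodup :=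
  I.nodes_nodup.filter _

theorem get_nodesIn_injective (S : Set (Fin I.n)) : Function.Injective (I.nodesIn S).get :=
  (List.nodup_iff_injective_get.1 (I.nodesIn_nodup S))

theorem get_nodesIn_mem (S : Set (Fin I.n)) (i) : (I.nodesIn S).get i ∈ S :=
  I.mem_nodesIn.1 (List.get_mem _ _)

theorem exists_get_nodesIn {S : Set (Fin I.n)} {v : Fin I.n} (hv : v ∈ S) :
    ∃ i, (I.nodesIn S).get i = v :=
  List.mem_iff_get.1 (I.mem_nodesIn.2 hv)

/-- The set `S` of nodes induces a connected subgraph. -/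
def Conn (S : Set (Fin I.n)) : Prop := (I.graph.induce S).Connected

/-- The graph induced by `S`, with its nodes numbered in the order of their identities. -/
noncomputable def inducedIso (S : Set (Fin I.n)) :
    I.graph.comap (I.nodesIn S).get ≃g I.graph.induce S where
  toEquiv := Equiv.ofBijective (fun i => ⟨(I.nodesIn S).get i, I.get_nodesIn_mem S i⟩)
    ⟨fun _ _ h => I.get_nodesIn_injective S (congrArg Subtype.val h),
      fun v => (I.exists_get_nodesIn v.2).imp fun _ h => Subtype.ext h⟩
  map_rel_iff' := Iff.rfl

/-- The restriction of a triplet to a connected set of nodes. -/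
noncomputable def restrict (S : Set (Fin I.n)) (h : I.Conn S) : IdConfig where
  n := (I.nodesIn S).length
  graph := I.graph.comap (I.nodesIn S).get
  connected := (I.inducedIso S).connected_iff.2 h
  input i := I.input ((I.nodesIn S).get i)
  ident i := I.ident ((I.nodesIn S).get i)
  ident_injective := I.ident_injective.comp (I.get_nodesIn_injective S)

/-- The embedding of a restriction. -/
noncomputable def restrictEmb (S : Set (Fin I.n)) (h : I.Conn S) :
    (I.restrict S h).graph ↪g I.graph where
  toFun := (I.nodesIn S).get
  inj' := I.get_nodesIn_injective S
  map_rel_iff' := Iff.rfl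

theorem restrictEmb_mem (S : Set (Fin I.n)) (h : I.Conn S) (i) : I.restrictEmb S h i ∈ S :=
  I.get_nodesIn_mem S i

theorem exists_restrictEmb {S : Set (Fin I.n)} (h : I.Conn S) {v : Fin I.n} (hv : v ∈ S) :
    ∃ i, I.restrictEmb S h i = v :=
  I.exists_get_nodesIn hv

theorem map_restrictEmb_finRange (S : Set (Fin I.n)) (h : I.Conn S) :
    (List.finRange (I.restrict S h).n).map (I.restrictEmb S h) = I.nodesIn S :=
  List.map_get_finRange _

/-- `S` induces a prefix that belongs to `L`. -/
def Accepts (L : DistributedLanguage) (S : Set (Fin I.n)) : Prop :=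
  ∃ h : I.Conn S, (I.restrict S h).toConfig ∈ L.carrier

theorem isPrefix_restrict {S S' : Set (Fin I.n)} (h : I.Conn S) (h' : I.Conn S') (hS : S ⊆ S') :
    IsPrefix (I.restrict S h).toConfig (I.restrict S' h').toConfig := by
  choose f hf using fun i => I.exists_restrictEmb h' (hS (I.restrictEmb_mem S h i))
  refine ⟨⟨⟨f, fun i j hij => ?_⟩, ?_⟩, fun i => ?_⟩
  · apply (I.restrictEmb S h).injective
    rw [← hf, ← hf, hij]
  · intro i j
    rw [← (I.restrictEmb S h).map_rel_iff, ← (I.restrictEmb S' h').map_rel_iff]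
    exact iff_of_eq (congrArg₂ _ (hf i) (hf j))
  · exact congrArg I.input (hf i).symm

theorem Accepts.mono {L : DistributedLanguage} (hL : L.Hereditary) {S S' : Set (Fin I.n)}
    (hS' : I.Accepts L S') (hS : S ⊆ S') (h : I.Conn S) : I.Accepts L S :=
  ⟨h, hL _ hS'.2 _ (I.isPrefix_restrict h hS'.1 hS)⟩

theorem conn_univ : I.Conn Set.univ :=
  (SimpleGraph.induceUnivIso I.graph).connected_iff.2 I.connected

/-- Renumbering the nodes by identity gives an isomorphic configuration; heredity, used in both
directions, absorbs the isomorphism. -/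
theorem accepts_univ {L : DistributedLanguage} (hL : L.Hereditary) :
    I.Accepts L Set.univ ↔ I.toConfig ∈ L.carrier := by
  constructor
  · rintro ⟨h, hm⟩
    choose f hf using fun i => I.exists_restrictEmb h (Set.mem_univ i)
    refine hL _ hm _ ⟨⟨⟨f, fun i j hij => ?_⟩, ?_⟩, fun i => ?_⟩
    · rw [← hf i, ← hf j, hij]
    · intro i j
      rw [← (I.restrictEmb _ h).map_rel_iff]
      exact iff_of_eq (congrArg₂ _ (hf i) (hf j))
    · exact congrArg I.input (hf i).symm
  · exact fun hm => ⟨I.conn_univ, hL _ hm _ ⟨I.restrictEmb _ _, fun _ => rfl⟩⟩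

end IdConfig

/-! ### Executions on induced subgraphs, coupled through common coins -/

namespace LocalAlgorithm

variable (A : LocalAlgorithm) (I : IdConfig)

open Classical in
/-- What `v` receives from its neighbours in `S`. -/
noncomputable def inboxOn (S : Set (Fin I.n)) (s : Fin I.n → ℕ) (v : Fin I.n) : List (ℤ × ℕ) :=
  ((I.nodesIn S).filter fun u => decide (I.graph.Adj v u)).map fun u => (I.ident u, A.send (s u))

/-- The memory states in the execution on the subgraph induced by `S`. -/
noncomputable def stateOn (S : Set (Fin I.n)) (ω : CoinSpace I.n) : ℕ → Fin I.n → ℕ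
  | 0, v =>
      A.init ((I.ident v, I.input v), coins ω v 0 (A.initCoins (I.ident v, I.input v)))
  | r + 1, v =>
      A.step ((stateOn S ω r v, A.inboxOn I S (stateOn S ω r) v),
        coins ω v (r + 1) (A.stepCoins (stateOn S ω r v, A.inboxOn I S (stateOn S ω r) v)))

/-- The first output of `v` in the execution on the subgraph induced by `S` is `b`. -/
def OutputsOn (S : Set (Fin I.n)) (ω : CoinSpace I.n) (v : Fin I.n) (b : Bool) : Prop :=
  ∃ r, A.out (A.stateOn I S ω r v) = some b ∧ ∀ s < r, A.out (A.stateOn I S ω s v) = none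

/-- The coins of the nodes of `S`. -/
noncomputable def _root_.LocalDecision.IdConfig.restrictCoins (S : Set (Fin I.n)) (h : I.Conn S)
    (ω : CoinSpace I.n) : CoinSpace (I.restrict S h).n :=
  fun x => ω (I.restrictEmb S h x.1, x.2)

theorem pairwise_inboxOn (S : Set (Fin I.n)) (s : Fin I.n → ℕ) (v : Fin I.n) :
    (A.inboxOn I S s v).Pairwise fun a b => a.1 < b.1 :=
  List.pairwise_map.2 ((I.pairwise_nodesIn S).filter _)

/-- Both lists carry the same messages in increasing order of pairwise distinct identities, which
determines the list. -/
theorem inbox_restrict (S : Set (Fin I.n)) (h : I.Conn S) (s : Fin I.n → ℕ)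
    (v : Fin (I.restrict S h).n) :
    A.inbox (I.restrict S h) (fun i => s (I.restrictEmb S h i)) v =
      A.inboxOn I S s (I.restrictEmb S h v) := by
  classical
  refine eq_of_perm_of_pairwise_fst ((List.perm_insertionSort _ _).trans ?_) ?_
    (A.pairwise_inboxOn I S s _)
  · rw [inboxOn, ← I.map_restrictEmb_finRange S h, List.filter_map, List.map_map]
    exact List.Perm.of_eq (by congr!)
  · have : Std.Total fun a b : ℤ × ℕ => a.1 ≤ b.1 := ⟨fun a b => le_total _ _⟩
    have : IsTrans (ℤ × ℕ) fun a b : ℤ × ℕ => a.1 ≤ b.1 := ⟨fun a b c => le_trans⟩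
    exact List.pairwise_insertionSort _ _

/-- This identifies the coupled executions, defined for every set of nodes, with genuine executions
when the set is connected, so that the guarantees on `A` apply to them. -/
theorem state_restrict (S : Set (Fin I.n)) (h : I.Conn S) (ω : CoinSpace I.n) (r : ℕ) :
    A.state (I.restrict S h) (I.restrictCoins S h ω) r =
      fun v => A.stateOn I S ω r (I.restrictEmb S h v) := by
  induction r with
  | zero => rfl
  | succ r ih =>
    funext v
    simp only [state, ih]
    rw [A.inbox_restrict I S h (A.stateOn I S ω r)]
    rfl

theorem outputs_restrict (S : Set (Fin I.n)) (h : I.Conn S) (ω : CoinSpace I.n)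
    (v : Fin (I.restrict S h).n) (b : Bool) :
    A.Outputs (I.restrict S h) (I.restrictCoins S h ω) v b ↔
      A.OutputsOn I S ω (I.restrictEmb S h v) b := by
  simp only [Outputs, OutputsOn, state_restrict]

/-- Monotonicity of `t` enters here: a single bound `t I` serves all connected induced subgraphs. -/
theorem exists_out_stateOn {t : IdConfig → ℝ} (ht : NonDecreasing t) (hA : A.RunsInTime t)
    {S : Set (Fin I.n)} (h : I.Conn S) (ω : CoinSpace I.n) {v : Fin I.n} (hv : v ∈ S) :
    ∃ r : ℕ, (r : ℝ) ≤ t I ∧ (A.out (A.stateOn I S ω r v)).isSome := by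
  obtain ⟨i, rfl⟩ := I.exists_restrictEmb h hv
  obtain ⟨r, hr, hs⟩ := hA (I.restrict S h) (I.restrictCoins S h ω) i
  rw [state_restrict] at hs
  exact ⟨r, hr.trans (ht _ _ (I.restrictEmb S h) (fun _ => rfl) fun _ => rfl), hs⟩

/-- The state of a node depends on the part of the graph and on the coins in its vicinity. -/
theorem stateOn_congr {S S' : Set (Fin I.n)} {ω ω' : CoinSpace I.n} (D : ℕ → Set (Fin I.n))
    (hD : ∀ r, ∀ v ∈ D (r + 1), v ∈ D r ∧
      ∀ u, I.graph.Adj v u → (u ∈ S ↔ u ∈ S') ∧ (u ∈ S → u ∈ D r))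
    (hω : ∀ r, ∀ v ∈ D r, ∀ i, ω (v, r, i) = ω' (v, r, i)) (r : ℕ) :
    ∀ v ∈ D r, A.stateOn I S ω r v = A.stateOn I S' ω' r v := by
  have hc : ∀ r, ∀ v ∈ D r, ∀ k, coins ω v r k = coins ω' v r k := fun r v hv k => by
    simp only [coins, hω r v hv]
  induction r with
  | zero => exact fun v hv => by rw [stateOn, stateOn, hc 0 v hv]
  | succ r ih =>
    intro v hv
    obtain ⟨hv', hu⟩ := hD r v hv
    have hin : A.inboxOn I S (A.stateOn I S ω r) v = A.inboxOn I S' (A.stateOn I S' ω' r) v := by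
      classical
      simp only [inboxOn, IdConfig.nodesIn, List.filter_filter]
      have : (I.nodes.filter fun u => decide (I.graph.Adj v u) && decide (u ∈ S)) =
          I.nodes.filter fun u => decide (I.graph.Adj v u) && decide (u ∈ S') := by
        refine List.filter_congr fun u _ => ?_
        by_cases h : I.graph.Adj v u
        · simp [h, (hu u h).1]
        · simp [h]
      rw [← this]
      refine List.map_congr_left fun u hu' => ?_
      simp only [List.mem_filter, Bool.and_eq_true, decide_eq_true_eq] at hu'
      rw [ih u ((hu u hu'.2.1).2 hu'.2.2)]
    rw [stateOn, stateOn, hin, ih v hv', hc _ v hv]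

theorem outputsOn_unique {S : Set (Fin I.n)} {ω : CoinSpace I.n} {v : Fin I.n} {b b' : Bool}
    (h : A.OutputsOn I S ω v b) (h' : A.OutputsOn I S ω v b') : b = b' := by
  obtain ⟨r, hr, hr'⟩ := h
  obtain ⟨s, hs, hs'⟩ := h'
  rcases lt_trichotomy r s with hlt | rfl | hlt
  · simp [hs' r hlt] at hr
  · simpa [hr] using hs
  · simp [hr' s hlt] at hs

theorem exists_outputsOn {S : Set (Fin I.n)} {ω : CoinSpace I.n} {v : Fin I.n} {r : ℕ}
    (h : (A.out (A.stateOn I S ω r v)).isSome) : ∃ b, A.OutputsOn I S ω v b := by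
  classical
  have hex : ∃ r, (A.out (A.stateOn I S ω r v)).isSome := ⟨r, h⟩
  obtain ⟨b, hb⟩ := Option.isSome_iff_exists.1 (Nat.find_spec hex)
  exact ⟨b, _, hb, fun s hs => by simpa using Nat.find_min hex hs⟩

/-- Executions that agree up to the time of the output have the same output. -/
theorem outputsOn_iff_of_agree {S S' : Set (Fin I.n)} {ω ω' : CoinSpace I.n} {v : Fin I.n} {T : ℕ}
    (hT : ∃ r ≤ T, (A.out (A.stateOn I S ω r v)).isSome)
    (h : ∀ r ≤ T, A.stateOn I S ω r v = A.stateOn I S' ω' r v) (b : Bool) :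
    A.OutputsOn I S ω v b ↔ A.OutputsOn I S' ω' v b := by
  have key : ∀ b, A.OutputsOn I S ω v b → A.OutputsOn I S' ω' v b := by
    rintro b ⟨r, hr, hr'⟩
    obtain ⟨r₀, hr₀, hs⟩ := hT
    have hrT : r ≤ T := by
      by_contra hlt
      rw [hr' r₀ (by omega)] at hs
      simp at hs
    exact ⟨r, h r hrT ▸ hr, fun s hs => h s (hs.le.trans hrT) ▸ hr' s hs⟩
  refine ⟨key b, fun hb => ?_⟩
  -- For the converse, the first execution has some output; `key` transfers it, and outputs are
  -- unique.
  obtain ⟨r₀, -, hs⟩ := hT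
  obtain ⟨b', hb'⟩ := A.exists_outputsOn I hs
  rwa [← A.outputsOn_unique I (key b' hb') hb]

end LocalAlgorithm

/-! ### Enumeration of coin strings and simulation of all executions -/

/-- What is known about a node: its identity, its input, and the identities of its neighbours. -/
abbrev NodeRecord : Type := (ℤ × List Bool) × List ℤ

/-- All strings of `k` bits. -/
def coinStrings : ℕ → List (List Bool)
  | 0 => [[]]
  | k + 1 => (coinStrings k).flatMap fun c => [true :: c, false :: c]

theorem mem_coinStrings {k : ℕ} {c : List Bool} : c ∈ coinStrings k ↔ c.length = k := by
  induction k generalizing c with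
  | zero => simp [coinStrings]
  | succ k ih =>
    rcases c with _ | ⟨b, c⟩
    · simp [coinStrings]
    · cases b <;> simp [coinStrings, ih]

theorem computable_coinStrings : Computable coinStrings := by
  refine (Computable.nat_rec (h := fun _ (p : ℕ × List (List Bool)) =>
    p.2.flatMap fun c => [true :: c, false :: c]) Computable.id (Computable.const [[]])
    ?_).of_eq fun k => ?_
  · refine Computable.list_flatMap (Computable.snd.comp Computable.snd) ?_
    exact Computable.list_cons.comp (Computable.list_cons.comp (Computable.const true)
      Computable.snd) (Computable.list_cons.comp (Computable.list_cons.comp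
        (Computable.const false) Computable.snd) (Computable.const []))
  · induction k with
    | zero => rfl
    | succ k ih => rw [coinStrings, ← ih]; rfl

/-- Without repetitions in `l`, choices made entry by entry assemble into one function on the nodes.
-/
theorem mem_sections_map_coinStrings {ι γ : Type*} {l : List ι} (hl : l.Nodup) {k : ι → ℕ}
    {G : ι → List Bool → γ} {J : List γ} :
    J ∈ (l.map fun v => (coinStrings (k v)).map (G v)).sections ↔
      ∃ c : ι → List Bool, (∀ v ∈ l, (c v).length = k v) ∧ J = l.map fun v => G v (c v) := by
  classical
  induction l generalizing J with
  | nil => simp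
  | cons a l ih =>
    rw [List.nodup_cons] at hl
    simp only [List.map_cons, List.sections, List.mem_flatMap, List.mem_map, ih hl.2,
      mem_coinStrings]
    constructor
    · rintro ⟨_, ⟨c, hc, rfl⟩, _, ⟨d, hd, rfl⟩, rfl⟩
      have hne : ∀ v ∈ l, v ≠ a := fun v hv h => hl.1 (h ▸ hv)
      refine ⟨Function.update c a d, ?_, ?_⟩
      · intro v hv
        rcases List.mem_cons.1 hv with rfl | hv
        · simpa using hd
        · rw [Function.update_of_ne (hne v hv)]
          exact hc v hv
      · rw [Function.update_self]
        refine congrArg _ (List.map_congr_left fun v hv => ?_)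
        rw [Function.update_of_ne (hne v hv)]
    · rintro ⟨c, hc, rfl⟩
      exact ⟨_, ⟨c, fun v hv => hc v (List.mem_cons_of_mem _ hv), rfl⟩, _,
        ⟨c a, hc a List.mem_cons_self, rfl⟩, rfl⟩

/-- Replace the coins of round `r` by given strings. -/
def overrideCoins {n : ℕ} (ω : CoinSpace n) (r : ℕ) (c : Fin n → List Bool) : CoinSpace n :=
  fun x => if x.2.1 = r then (c x.1).getD x.2.2 false else ω x

theorem coins_overrideCoins {n : ℕ} (ω : CoinSpace n) (r : ℕ) (c : Fin n → List Bool) (v : Fin n)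
    {k : ℕ} (h : (c v).length = k) : coins (overrideCoins ω r c) v r k = c v := by
  subst h
  refine List.ext_getElem (by simp [coins]) fun i h₁ h₂ => ?_
  simp [coins, overrideCoins]

theorem length_coins {n : ℕ} (ω : CoinSpace n) (v : Fin n) (r k : ℕ) :
    (coins ω v r k).length = k := by simp [coins]

namespace LocalAlgorithm

variable (A : LocalAlgorithm)

/-! ### Simulation of an algorithm on a list of node records -/

/-- The messages received by a node, where `J` lists all nodes with their states. -/
def recordInbox (J : List (NodeRecord × ℕ)) (x : NodeRecord) : List (ℤ × ℕ) :=
  (J.filter fun y => decide (y.1.1.1 ∈ x.2)).map fun y => (y.1.1.1, A.send y.2)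

/-- The possible states before the first round. -/
def initSnapshots (R : List NodeRecord) : List (List (NodeRecord × ℕ)) :=
  (R.map fun x => (coinStrings (A.initCoins x.1)).map fun c => (x, A.init (x.1, c))).sections

/-- The possible states after one more round. -/
def nextSnapshots (J : List (NodeRecord × ℕ)) : List (List (NodeRecord × ℕ)) :=
  (J.map fun y => (coinStrings (A.stepCoins (y.2, A.recordInbox J y.1))).map fun c =>
    (y.1, A.step ((y.2, A.recordInbox J y.1), c))).sections

/-- The node with identity `w` has no output. -/
def pending (w : ℤ) (J : List (NodeRecord × ℕ)) : Bool :=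
  J.any fun y => decide (y.1.1.1 = w) && (A.out y.2).isNone

/-- The possible states after `r` rounds of the executions in which the node with identity `w`
has no output so far. -/
def pendingSnapshots (w : ℤ) (R : List NodeRecord) : ℕ → List (List (NodeRecord × ℕ))
  | 0 => (A.initSnapshots R).filter (A.pending w)
  | r + 1 => ((pendingSnapshots w R r).flatMap A.nextSnapshots).filter (A.pending w)

/-- In every induced subgraph, the node with identity `w` has an output after `k` rounds. -/
def settled (w : ℤ) (R : List NodeRecord) (k : ℕ) : Bool :=
  R.sublists'.all fun U =>
    (!(U.any fun x => decide (x.1.1 = w))) || (A.pendingSnapshots w U k).isEmpty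

variable {A} {I : IdConfig} {S : Set (Fin I.n)} {nb : Fin I.n → List ℤ}

theorem recordInbox_snapshot (hnb : ∀ u ∈ S, ∀ v ∈ S, I.ident u ∈ nb v ↔ I.graph.Adj v u)
    (s : Fin I.n → ℕ) {v : Fin I.n} (hv : v ∈ S) :
    A.recordInbox ((I.nodesIn S).map fun u => (((I.ident u, I.input u), nb u), s u))
      ((I.ident v, I.input v), nb v) = A.inboxOn I S s v := by
  classical
  rw [recordInbox, inboxOn, List.filter_map, List.map_map]
  have : (I.nodesIn S).filter ((fun y : NodeRecord × ℕ => decide (y.1.1.1 ∈ nb v)) ∘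
      fun u => (((I.ident u, I.input u), nb u), s u)) =
      (I.nodesIn S).filter fun u => decide (I.graph.Adj v u) :=
    List.filter_congr fun u hu => by
      simp [hnb u (I.mem_nodesIn.1 hu) v hv]
  rw [this]
  rfl

theorem pending_snapshot (s : Fin I.n → ℕ) {w : Fin I.n} (hw : w ∈ S) :
    A.pending (I.ident w)
      ((I.nodesIn S).map fun u => (((I.ident u, I.input u), nb u), s u)) = true ↔
      A.out (s w) = none := by
  simp only [pending, List.any_map, List.any_eq_true, Function.comp, Bool.and_eq_true,
    decide_eq_true_eq, Option.isNone_iff_eq_none]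
  constructor
  · rintro ⟨u, -, hu, h⟩
    rwa [← I.ident_injective hu]
  · exact fun h => ⟨w, I.mem_nodesIn.2 hw, rfl, h⟩

/-- Later coins do not influence earlier states, so a simulated execution can be extended round by
round. -/
theorem stateOn_overrideCoins (ω : CoinSpace I.n) (r : ℕ) (c : Fin I.n → List Bool) {s : ℕ}
    (hs : s < r) : A.stateOn I S (overrideCoins ω r c) s = A.stateOn I S ω s := by
  funext v
  refine A.stateOn_congr I (fun s => {_v | s < r}) ?_ ?_ s v hs
  · intro s v hv
    exact ⟨Nat.lt_of_succ_lt hv, fun u _ => ⟨Iff.rfl, fun _ => Nat.lt_of_succ_lt hv⟩⟩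
  · intro s v hv i
    exact if_neg (Nat.ne_of_lt hv)

/-- The coin space is infinite, but the current states determine how many bits are tossed next.
Hence finitely many snapshots represent all executions in which `w` is still undecided. -/
theorem mem_pendingSnapshots (hnb : ∀ u ∈ S, ∀ v ∈ S, I.ident u ∈ nb v ↔ I.graph.Adj v u)
    {w : Fin I.n} (hw : w ∈ S) (r : ℕ) (J : List (NodeRecord × ℕ)) :
    J ∈ A.pendingSnapshots (I.ident w)
        ((I.nodesIn S).map fun u => ((I.ident u, I.input u), nb u)) r ↔
      ∃ ω : CoinSpace I.n, (∀ s ≤ r, A.out (A.stateOn I S ω s w) = none) ∧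
        J = (I.nodesIn S).map fun u => (((I.ident u, I.input u), nb u), A.stateOn I S ω r u) := by
  induction r generalizing J with
  | zero =>
    rw [pendingSnapshots, List.mem_filter, initSnapshots, List.map_map]
    refine (and_congr_left' (mem_sections_map_coinStrings (I.nodesIn_nodup S)
      (k := fun u => A.initCoins (I.ident u, I.input u))
      (G := fun u c => (((I.ident u, I.input u), nb u),
        A.init ((I.ident u, I.input u), c))))).trans ?_
    constructor
    · rintro ⟨⟨c, hc, rfl⟩, hp⟩
      have hst : ∀ u ∈ I.nodesIn S, A.stateOn I S (overrideCoins (fun _ => false) 0 c) 0 u =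
          A.init ((I.ident u, I.input u), c u) := fun u hu => by
        rw [stateOn, coins_overrideCoins _ _ _ _ (hc u hu)]
      refine ⟨overrideCoins (fun _ => false) 0 c, fun s hs => ?_, ?_⟩
      · obtain rfl := Nat.le_zero.1 hs
        rw [hst w (I.mem_nodesIn.2 hw)]
        exact (pending_snapshot _ hw).1 hp
      · exact List.map_congr_left fun u hu => by rw [hst u hu]
    · rintro ⟨ω, hω, rfl⟩
      exact ⟨⟨fun u => coins ω u 0 (A.initCoins (I.ident u, I.input u)),
        fun u _ => length_coins _ _ _ _, rfl⟩, (pending_snapshot _ hw).2 (hω 0 le_rfl)⟩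
  | succ r ih =>
    have next : ∀ ω : CoinSpace I.n, ∀ J, J ∈ A.nextSnapshots ((I.nodesIn S).map fun u =>
        (((I.ident u, I.input u), nb u), A.stateOn I S ω r u)) ↔
        ∃ c : Fin I.n → List Bool, (∀ u ∈ I.nodesIn S, (c u).length =
          A.stepCoins (A.stateOn I S ω r u, A.inboxOn I S (A.stateOn I S ω r) u)) ∧
          J = (I.nodesIn S).map fun u => (((I.ident u, I.input u), nb u),
            A.step ((A.stateOn I S ω r u, A.inboxOn I S (A.stateOn I S ω r) u), c u)) := by
      intro ω J
      rw [← mem_sections_map_coinStrings (I.nodesIn_nodup S)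
        (k := fun u => A.stepCoins (A.stateOn I S ω r u, A.inboxOn I S (A.stateOn I S ω r) u))
        (G := fun u c => (((I.ident u, I.input u), nb u),
          A.step ((A.stateOn I S ω r u, A.inboxOn I S (A.stateOn I S ω r) u), c))),
        nextSnapshots, List.map_map]
      refine iff_of_eq (congrArg (J ∈ List.sections ·) (List.map_congr_left fun u hu => ?_))
      simp only [Function.comp, recordInbox_snapshot hnb _ (I.mem_nodesIn.1 hu)]
    rw [pendingSnapshots, List.mem_filter, List.mem_flatMap]
    constructor
    · rintro ⟨⟨J', hJ', hJ⟩, hp⟩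
      obtain ⟨ω, hω, rfl⟩ := (ih J').1 hJ'
      obtain ⟨c, hc, rfl⟩ := (next ω J).1 hJ
      have hst : ∀ u ∈ I.nodesIn S, A.stateOn I S (overrideCoins ω (r + 1) c) (r + 1) u =
          A.step ((A.stateOn I S ω r u, A.inboxOn I S (A.stateOn I S ω r) u), c u) :=
        fun u hu => by
          rw [stateOn, stateOn_overrideCoins ω (r + 1) c (Nat.lt_succ_self r),
            coins_overrideCoins _ _ _ _ (hc u hu)]
      refine ⟨overrideCoins ω (r + 1) c, fun s hs => ?_, ?_⟩
      · rcases Nat.lt_or_eq_of_le hs with hs | rfl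
        · rw [stateOn_overrideCoins ω (r + 1) c hs]
          exact hω s (Nat.lt_succ_iff.1 hs)
        · rw [hst w (I.mem_nodesIn.2 hw)]
          exact (pending_snapshot _ hw).1 hp
      · exact List.map_congr_left fun u hu => by rw [hst u hu]
    · rintro ⟨ω, hω, rfl⟩
      exact ⟨⟨_, (ih _).2 ⟨ω, fun s hs => hω s (hs.trans r.le_succ), rfl⟩, (next ω _).2
        ⟨fun u => coins ω u (r + 1) (A.stepCoins (A.stateOn I S ω r u,
          A.inboxOn I S (A.stateOn I S ω r) u)), fun u _ => length_coins _ _ _ _, rfl⟩⟩,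
        (pending_snapshot _ hw).2 (hω _ le_rfl)⟩

/-- The simulation determines whether `w` has an output after `k` rounds in all executions. -/
theorem isEmpty_pendingSnapshots
    (hnb : ∀ u ∈ S, ∀ v ∈ S, I.ident u ∈ nb v ↔ I.graph.Adj v u) {w : Fin I.n} (hw : w ∈ S)
    (k : ℕ) :
    (A.pendingSnapshots (I.ident w)
        ((I.nodesIn S).map fun u => ((I.ident u, I.input u), nb u)) k).isEmpty = true ↔
      ∀ ω : CoinSpace I.n, ∃ s ≤ k, (A.out (A.stateOn I S ω s w)).isSome := by
  rw [List.isEmpty_iff, List.eq_nil_iff_forall_not_mem]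
  simp only [mem_pendingSnapshots hnb hw]
  constructor
  · intro h ω
    by_contra! hω
    exact h _ ⟨ω, fun s hs => by simpa using hω s hs, rfl⟩
  · rintro h J ⟨ω, hω, -⟩
    obtain ⟨s, hs, ho⟩ := h ω
    simp [hω s hs] at ho

theorem settled_iff (hnb : ∀ u ∈ S, ∀ v ∈ S, I.ident u ∈ nb v ↔ I.graph.Adj v u)
    {w : Fin I.n} (k : ℕ) :
    A.settled (I.ident w) ((I.nodesIn S).map fun u => ((I.ident u, I.input u), nb u)) k = true ↔
      ∀ U ⊆ S, w ∈ U → ∀ ω : CoinSpace I.n, ∃ s ≤ k, (A.out (A.stateOn I U ω s w)).isSome := by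
  classical
  rw [settled, List.all_eq_true]
  have hany : ∀ U : Set (Fin I.n), (((I.nodesIn U).map fun u =>
      ((I.ident u, I.input u), nb u)).any fun x => decide (x.1.1 = I.ident w)) = true ↔ w ∈ U := by
    intro U
    simp only [List.any_map, List.any_eq_true, Function.comp, decide_eq_true_eq]
    exact ⟨fun ⟨u, hu, h⟩ => I.ident_injective h ▸ I.mem_nodesIn.1 hu,
      fun h => ⟨w, I.mem_nodesIn.2 h, rfl⟩⟩
  have hsub : ∀ U ⊆ S, ∀ u ∈ U, ∀ v ∈ U, I.ident u ∈ nb v ↔ I.graph.Adj v u :=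
    fun U hU u hu v hv => hnb u (hU hu) v (hU hv)
  constructor
  · intro h U hU hw
    have hmem : ((I.nodesIn U).map fun u => ((I.ident u, I.input u), nb u)) ∈
        ((I.nodesIn S).map fun u => ((I.ident u, I.input u), nb u)).sublists' := by
      rw [List.mem_sublists']
      refine List.Sublist.map _ ?_
      rw [show I.nodesIn U = (I.nodesIn S).filter fun v => decide (v ∈ U) from ?_]
      · exact List.filter_sublist
      · rw [IdConfig.nodesIn, IdConfig.nodesIn, List.filter_filter]
        refine List.filter_congr fun v _ => ?_
        by_cases hv : v ∈ U
        · simp [hv, hU hv]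
        · simp [hv]
    have := h _ hmem
    rw [(hany U).2 hw, Bool.not_true, Bool.false_or] at this
    exact (isEmpty_pendingSnapshots (hsub U hU) hw k).1 this
  · intro h R hR
    rw [List.mem_sublists', List.sublist_map_iff] at hR
    obtain ⟨l, hl, rfl⟩ := hR
    -- A sublist inherits the order by identity, so it is the ordered list of the set of its own
    -- entries: sublists amount to subsets of `S`.
    have hlU : l = I.nodesIn {v | v ∈ l} := by
      refine List.Perm.eq_of_pairwise (le := fun a b => I.ident a < I.ident b)
        (fun a b _ _ h h' => absurd h h'.asymm) ((I.pairwise_nodesIn S).sublist hl)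
        (I.pairwise_nodesIn _) ?_
      rw [List.perm_ext_iff_of_nodup ((I.nodesIn_nodup S).sublist hl) (I.nodesIn_nodup _)]
      exact fun v => (I.mem_nodesIn (S := {v | v ∈ l})).symm
    have hU : {v | v ∈ l} ⊆ S := fun v hv => I.mem_nodesIn.1 (hl.subset hv)
    generalize {v | v ∈ l} = U at hlU hU
    subst hlU
    by_cases hw : w ∈ U
    · rw [(isEmpty_pendingSnapshots (hsub U hU) hw k).2 (h U hU hw), Bool.or_true]
    · rw [Bool.eq_false_iff.2 (fun h => hw ((hany U).1 h)), Bool.not_false, Bool.true_or]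

end LocalAlgorithm

/-! ### Balls, distances and connectivity in induced subgraphs -/

namespace IdConfig

variable (I : IdConfig)

/-- The nodes at distance at most `k` from `w` in the subgraph induced by `S`. -/
def ball (S : Set (Fin I.n)) (w : Fin I.n) : ℕ → Set (Fin I.n)
  | 0 => {w}
  | k + 1 => ball S w k ∪ {u | u ∈ S ∧ ∃ x ∈ ball S w k, I.graph.Adj x u}

variable {I} {S S' : Set (Fin I.n)} {v w u x : Fin I.n} {j k : ℕ}

theorem ball_mono_radius (h : j ≤ k) : I.ball S w j ⊆ I.ball S w k :=
  monotone_nat_of_le_succ (fun _ => Set.subset_union_left) h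

theorem self_mem_ball : w ∈ I.ball S w k :=
  ball_mono_radius k.zero_le (Set.mem_singleton w)

theorem ball_subset (hw : w ∈ S) : I.ball S w k ⊆ S := by
  induction k with
  | zero => exact Set.singleton_subset_iff.2 hw
  | succ k ih => exact Set.union_subset ih fun u hu => hu.1

theorem ball_mono (h : S ⊆ S') : I.ball S w k ⊆ I.ball S' w k := by
  induction k with
  | zero => exact subset_rfl
  | succ k ih =>
    rintro u (hu | ⟨hu, x, hx, hxu⟩)
    · exact Or.inl (ih hu)
    · exact Or.inr ⟨h hu, x, ih hx, hxu⟩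

theorem mem_ball_succ (hu : u ∈ S) (hx : x ∈ I.ball S w k) (h : I.graph.Adj x u) :
    u ∈ I.ball S w (k + 1) :=
  Or.inr ⟨hu, x, hx, h⟩

theorem mem_ball_trans (hx : x ∈ I.ball S w j) (hu : u ∈ I.ball S x k) :
    u ∈ I.ball S w (j + k) := by
  induction k generalizing u with
  | zero => rwa [Set.mem_singleton_iff.1 hu]
  | succ k ih =>
    rcases hu with hu | ⟨hu, y, hy, hyu⟩
    · exact ball_mono_radius (by omega) (ih hu)
    · exact mem_ball_succ hu (ih hy) hyu

theorem mem_ball_symm (hw : w ∈ S) (hu : u ∈ I.ball S w k) : w ∈ I.ball S u k := by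
  induction k generalizing u with
  | zero =>
    rw [Set.mem_singleton_iff.1 hu]
    exact self_mem_ball
  | succ k ih =>
    rcases hu with hu | ⟨hu, y, hy, hyu⟩
    · exact ball_mono_radius k.le_succ (ih hu)
    · rw [add_comm]
      exact mem_ball_trans (mem_ball_succ (ball_subset hw hy) self_mem_ball hyu.symm) (ih hy)

/-- Paths are split at their first edge instead of their last, matching the way records spread: a
node learns what its neighbours knew. -/
theorem mem_ball_univ_succ : u ∈ I.ball Set.univ w (k + 1) ↔
    u ∈ I.ball Set.univ w k ∨ ∃ x, I.graph.Adj w x ∧ u ∈ I.ball Set.univ x k := by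
  constructor
  · induction k generalizing u with
    | zero =>
      rintro (hu | ⟨-, x, hx, hxu⟩)
      · exact Or.inl hu
      · obtain rfl := Set.mem_singleton_iff.1 hx
        exact Or.inr ⟨u, hxu, self_mem_ball⟩
    | succ k ih =>
      rintro (hu | ⟨-, y, hy, hyu⟩)
      · exact Or.inl hu
      · rcases ih hy with hy | ⟨x, hx, hy⟩
        · exact Or.inl (mem_ball_succ trivial hy hyu)
        · exact Or.inr ⟨x, hx, mem_ball_succ trivial hy hyu⟩
  · rintro (hu | ⟨x, hx, hu⟩)
    · exact Or.inl hu
    · rw [add_comm]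
      exact mem_ball_trans (mem_ball_succ trivial self_mem_ball hx) hu

theorem conn_of_reachable (hw : w ∈ S)
    (h : ∀ u (hu : u ∈ S), (I.graph.induce S).Reachable ⟨w, hw⟩ ⟨u, hu⟩) : I.Conn S := by
  have : Nonempty S := ⟨⟨w, hw⟩⟩
  exact ⟨fun a b => (h a a.2).symm.trans (h b b.2)⟩

theorem reachable_of_ball_subset (hw : w ∈ S') (hS : I.ball S w k ⊆ S') (hu : u ∈ I.ball S w k) :
    (I.graph.induce S').Reachable ⟨w, hw⟩ ⟨u, hS hu⟩ := by
  induction k generalizing u with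
  | zero =>
    obtain rfl := Set.mem_singleton_iff.1 hu
    exact SimpleGraph.Reachable.refl _
  | succ k ih =>
    have hk : I.ball S w k ⊆ S' := (ball_mono_radius k.le_succ).trans hS
    rcases hu with hu' | ⟨hu', y, hy, hyu⟩
    · exact ih hk hu'
    · refine (ih hk hy).trans (SimpleGraph.Adj.reachable ?_)
      exact hyu

theorem conn_ball : I.Conn (I.ball S w k) :=
  conn_of_reachable self_mem_ball fun _ hu => reachable_of_ball_subset _ subset_rfl hu

theorem Conn.exists_mem_ball (h : I.Conn S) (hw : w ∈ S) (hu : u ∈ S) :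
    ∃ k, u ∈ I.ball S w k := by
  obtain ⟨p⟩ := h.preconnected ⟨w, hw⟩ ⟨u, hu⟩
  have key : ∀ (a b : S), (I.graph.induce S).Walk a b → ∃ k, (b : Fin I.n) ∈ I.ball S a k := by
    intro a b p
    induction p with
    | nil => exact ⟨0, self_mem_ball⟩
    | @cons a b c hab p ih =>
      obtain ⟨k, hk⟩ := ih
      exact ⟨1 + k, mem_ball_trans (mem_ball_succ b.2 self_mem_ball hab) hk⟩
  exact key _ _ p

variable (I) in
/-- The distance in the subgraph induced by `S`. -/
noncomputable def distIn (S : Set (Fin I.n)) (w u : Fin I.n) : ℕ :=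
  sInf {k | u ∈ I.ball S w k}

/-- Connectivity rules out the default value `0` of the infimum of the empty set. -/
theorem Conn.mem_ball_iff (h : I.Conn S) (hw : w ∈ S) (hu : u ∈ S) :
    u ∈ I.ball S w k ↔ I.distIn S w u ≤ k :=
  ⟨fun hk => Nat.sInf_le hk, fun hk =>
    ball_mono_radius hk (Nat.sInf_mem (s := {k | u ∈ I.ball S w k}) (h.exists_mem_ball hw hu))⟩

theorem distIn_self : I.distIn S w w = 0 :=
  Nat.le_zero.1 (Nat.sInf_le (s := {k | w ∈ I.ball S w k}) (show w ∈ I.ball S w 0 from self_mem_ball))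

theorem Conn.distIn_eq_zero (h : I.Conn S) (hw : w ∈ S) (hu : u ∈ S)
    (h0 : I.distIn S w u = 0) : u = w :=
  Set.mem_singleton_iff.1 ((h.mem_ball_iff (k := 0) hw hu).2 h0.le)

theorem Conn.distIn_le_succ (h : I.Conn S) (hw : w ∈ S) (hx : x ∈ S) (hu : u ∈ S)
    (hxu : I.graph.Adj x u) : I.distIn S w u ≤ I.distIn S w x + 1 :=
  (h.mem_ball_iff hw hu).1 (mem_ball_succ hu ((h.mem_ball_iff hw hx).2 le_rfl) hxu)

/-- Removing a node at maximal distance from `w` leaves a connected graph. -/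
theorem Conn.diff_singleton_of_farthest (h : I.Conn S) (hw : w ∈ S) (hwv : w ≠ v)
    (hv : ∀ u ∈ S, I.distIn S w u ≤ I.distIn S w v) : I.Conn (S \ {v}) := by
  refine conn_of_reachable (w := w) ⟨hw, hwv⟩ fun u hu => ?_
  induction hd : I.distIn S w u generalizing u with
  | zero =>
    obtain rfl := h.distIn_eq_zero hw hu.1 hd
    exact SimpleGraph.Reachable.refl _
  | succ k ih =>
    have hmem := (h.mem_ball_iff hw hu.1).2 hd.le
    have hnot : u ∉ I.ball S w k := fun hm => by
      have := (h.mem_ball_iff hw hu.1).1 hm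
      omega
    obtain hm | ⟨-, x, hx, hxu⟩ := hmem
    · exact absurd hm hnot
    · have hxS := ball_subset hw hx
      have hxk := (h.mem_ball_iff hw hxS).1 hx
      have := h.distIn_le_succ hw hxS hu.1 hxu
      have := hv u hu.1
      -- The predecessor `x` is strictly closer to `w` than `u`, and `v` is at maximal distance, so
      -- shortest paths to other nodes avoid `v`.
      have hxv : x ≠ v := by
        rintro rfl
        omega
      refine (ih x ⟨hxS, hxv⟩ (by omega)).trans (SimpleGraph.Adj.reachable ?_)
      exact hxu

end IdConfig

/-! ### Ordering the collected records -/

/-- The records ordered by identity, one for every identity. -/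
def sortRecords (R : List NodeRecord) : List NodeRecord :=
  R.foldr (fun x l => (l.filter fun y => decide (y.1.1 < x.1.1)) ++
    x :: l.filter fun y => decide (x.1.1 < y.1.1)) []

theorem pairwise_sortRecords (R : List NodeRecord) :
    (sortRecords R).Pairwise fun x y => x.1.1 < y.1.1 := by
  induction R with
  | nil => exact List.Pairwise.nil
  | cons x R ih =>
    rw [sortRecords, List.foldr_cons, ← sortRecords, List.pairwise_append, List.pairwise_cons]
    refine ⟨ih.filter _, ⟨?_, ih.filter _⟩, ?_⟩
    · intro y hy
      simpa using (List.mem_filter.1 hy).2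
    · intro a ha b hb
      have ha' : a.1.1 < x.1.1 := by simpa using (List.mem_filter.1 ha).2
      rcases List.mem_cons.1 hb with rfl | hb
      · exact ha'
      · exact ha'.trans (by simpa using (List.mem_filter.1 hb).2)

theorem mem_sortRecords {R : List NodeRecord}
    (hR : ∀ x ∈ R, ∀ y ∈ R, x.1.1 = y.1.1 → x = y) {z : NodeRecord} :
    z ∈ sortRecords R ↔ z ∈ R := by
  induction R with
  | nil => rfl
  | cons x R ih =>
    have ih' := ih fun a ha b hb =>
      hR a (List.mem_cons_of_mem _ ha) b (List.mem_cons_of_mem _ hb)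
    rw [sortRecords, List.foldr_cons, ← sortRecords]
    simp only [List.mem_append, List.mem_filter, List.mem_cons, ih', decide_eq_true_eq]
    constructor
    · rintro (⟨h, -⟩ | h | ⟨h, -⟩) <;> simp [h]
    · rintro (h | h)
      · exact Or.inr (Or.inl h)
      · rcases lt_trichotomy z.1.1 x.1.1 with hlt | heq | hlt
        · exact Or.inl ⟨h, hlt⟩
        · exact Or.inr (Or.inl (hR z (List.mem_cons_of_mem _ h) x List.mem_cons_self heq))
        · exact Or.inr (Or.inr ⟨h, hlt⟩)

/-- Collected records come in any order and with repetitions. As an identity determines its record,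
sorting yields a list that depends on the set `S` only. -/
theorem sortRecords_eq {I : IdConfig} {S : Set (Fin I.n)} {nb : Fin I.n → List ℤ}
    {R : List NodeRecord}
    (hR : ∀ x, x ∈ R ↔ ∃ u ∈ S, x = ((I.ident u, I.input u), nb u)) :
    sortRecords R = (I.nodesIn S).map fun u => ((I.ident u, I.input u), nb u) := by
  have : Std.Irrefl fun x y : NodeRecord => x.1.1 < y.1.1 := ⟨fun x => lt_irrefl _⟩
  have : Std.Antisymm fun x y : NodeRecord => x.1.1 < y.1.1 :=
    ⟨fun x y h h' => absurd h h'.asymm⟩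
  refine List.Pairwise.eq_of_mem_iff (pairwise_sortRecords R)
    (List.pairwise_map.2 (I.pairwise_nodesIn S)) fun z => ?_
  rw [mem_sortRecords, hR, List.mem_map]
  · simp only [I.mem_nodesIn, eq_comm]
  · intro x hx y hy hxy
    obtain ⟨u, -, rfl⟩ := (hR x).1 hx
    obtain ⟨v, -, rfl⟩ := (hR y).1 hy
    rw [I.ident_injective hxy]

/-- The code of the configuration described by a list of records. -/
def recordCode (R : List NodeRecord) : List (List Bool) × List (List Bool) :=
  (R.map fun x => x.1.2, R.map fun x => R.map fun y => decide (y.1.1 ∈ x.2))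

theorem recordCode_eq {I : IdConfig} {S : Set (Fin I.n)} {nb : Fin I.n → List ℤ}
    (hnb : ∀ u ∈ S, ∀ v ∈ S, I.ident u ∈ nb v ↔ I.graph.Adj v u) (h : I.Conn S) :
    recordCode ((I.nodesIn S).map fun u => ((I.ident u, I.input u), nb u)) =
      (I.restrict S h).toConfig.code := by
  classical
  rw [recordCode, Config.code, ← I.map_restrictEmb_finRange S h]
  simp only [List.map_map, List.ofFn_eq_map]
  refine congrArg₂ Prod.mk rfl (List.map_congr_left fun v _ => List.map_congr_left fun u _ => ?_)
  exact Bool.decide_congr (hnb _ (I.restrictEmb_mem S h u) _ (I.restrictEmb_mem S h v))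

/-! ### The deterministic algorithm -/

/-- The memory of a node that collects records: its identity, its input, the number of rounds,
and the records. -/
abbrev CollectorState : Type := ((ℤ × List Bool) × ℕ) × List NodeRecord

/-- Decoding of memory states. -/
def decodeCollector (s : ℕ) : CollectorState :=
  (Encodable.decode s).getD (((0, []), 0), [])

theorem decodeCollector_encode (s : CollectorState) :
    decodeCollector (Encodable.encode s) = s := by
  simp [decodeCollector]

/-- One round of collecting. -/
def collect (s : CollectorState) (m : List (ℤ × ℕ)) : CollectorState :=
  -- The first round replaces the provisional record, whose neighbour list is empty, by one listing
  -- the senders' identities; later rounds merge records.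
  ((s.1.1, s.1.2 + 1), bif decide (s.1.2 = 0) then [(s.1.1, m.map Prod.fst)] else
    s.2 ++ m.flatMap fun x => (decodeCollector x.2).2)

/-- The output of a collecting node: if the simulation of `A` on the collected part of the graph
is settled, membership of this part in the language. -/
def verdict (A : LocalAlgorithm) (f : List (List Bool) × List (List Bool) → Bool) (C : ℕ)
    (s : CollectorState) : Option Bool :=
  bif A.settled s.1.1.1 (sortRecords s.2) (s.1.2 / C) then some (f (recordCode (sortRecords s.2)))
  else none

/-! ### Computability of the collecting algorithm -/

section Computability

variable {α : Type*} [Primcodable α]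

theorem computable_sortRecords : Computable sortRecords := by
  refine Computable.list_foldr (h := fun _ (p : NodeRecord × List NodeRecord) =>
    (p.2.filter fun y => decide (y.1.1 < p.1.1.1)) ++
      p.1 :: p.2.filter fun y => decide (p.1.1.1 < y.1.1)) Computable.id (Computable.const []) ?_
  have hx : Computable fun q : (List NodeRecord × NodeRecord × List NodeRecord) × NodeRecord =>
      q.1.2.1.1.1 :=
    Computable.fst.comp (Computable.fst.comp
      (Computable.fst.comp (Computable.snd.comp Computable.fst)))
  have hy : Computable fun q : (List NodeRecord × NodeRecord × List NodeRecord) × NodeRecord =>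
      q.2.1.1 := Computable.fst.comp (Computable.fst.comp Computable.snd)
  exact Computable.list_append.comp
    (Computable.list_filter (Computable.snd.comp Computable.snd)
      (Primrec.int_lt.to_comp.comp hy hx))
    (Computable.list_cons.comp (Computable.fst.comp Computable.snd)
      (Computable.list_filter (Computable.snd.comp Computable.snd)
        (Primrec.int_lt.to_comp.comp hx hy)))

theorem computable_recordCode : Computable recordCode := by
  refine Computable.pair (Computable.list_map Computable.id
    (Computable.snd.comp (Computable.fst.comp Computable.snd))) ?_
  refine Computable.list_map Computable.id (Computable.list_map Computable.fst ?_)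
  exact Primrec.list_contains.to_comp.comp
    (Computable.snd.comp (Computable.snd.comp Computable.fst))
    (Computable.fst.comp (Computable.fst.comp Computable.snd))

theorem computable_decodeCollector : Computable decodeCollector :=
  Computable.option_getD Computable.decode (Computable.const _)

theorem computable_collect : Computable₂ collect := by
  refine Computable.pair (Computable.pair (Computable.fst.comp (Computable.fst.comp Computable.fst))
    (Computable.succ.comp (Computable.snd.comp (Computable.fst.comp Computable.fst)))) ?_
  refine Computable.cond ?_ ?_ ?_
  · exact (Primrec.eq.decide.to_comp.comp
      (Computable.snd.comp (Computable.fst.comp Computable.fst)) (Computable.const 0))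
  · exact Computable.list_cons.comp (Computable.pair
      (Computable.fst.comp (Computable.fst.comp Computable.fst))
      (Computable.list_map Computable.snd (Computable.fst.comp Computable.snd)))
      (Computable.const [])
  · exact Computable.list_append.comp (Computable.snd.comp Computable.fst)
      (Computable.list_flatMap Computable.snd (Computable.snd.comp
        (computable_decodeCollector.comp (Computable.snd.comp Computable.snd))))

namespace LocalAlgorithm

variable (A : LocalAlgorithm)

theorem computable_recordInbox : Computable₂ A.recordInbox := by
  refine Computable.list_map (Computable.list_filter Computable.fst ?_) ?_
  · exact Primrec.list_contains.to_comp.comp (Computable.snd.comp (Computable.snd.comp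
      Computable.fst)) (Computable.fst.comp (Computable.fst.comp
        (Computable.fst.comp Computable.snd)))
  · exact Computable.pair (Computable.fst.comp (Computable.fst.comp
      (Computable.fst.comp Computable.snd)))
      (A.computable_send.comp (Computable.snd.comp Computable.snd))

theorem computable_initSnapshots : Computable A.initSnapshots := by
  refine Computable.list_sections (Computable.list_map Computable.id (Computable.list_map
    (computable_coinStrings.comp (A.computable_initCoins.comp
      (Computable.fst.comp Computable.snd))) ?_))
  exact Computable.pair (Computable.snd.comp Computable.fst) (A.computable_init.comp
    (Computable.pair (Computable.fst.comp (Computable.snd.comp Computable.fst)) Computable.snd))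

theorem computable_nextSnapshots : Computable A.nextSnapshots := by
  have hin : Computable₂ fun (J : List (NodeRecord × ℕ)) (y : NodeRecord × ℕ) =>
      (y.2, A.recordInbox J y.1) :=
    Computable.pair (Computable.snd.comp Computable.snd)
      (A.computable_recordInbox.comp Computable.fst (Computable.fst.comp Computable.snd))
  refine Computable.list_sections (Computable.list_map Computable.id (Computable.list_map
    (computable_coinStrings.comp (A.computable_stepCoins.comp hin)) ?_))
  exact Computable.pair (Computable.fst.comp (Computable.snd.comp Computable.fst))
    (A.computable_step.comp (Computable.pair (hin.comp (Computable.fst.comp Computable.fst)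
      (Computable.snd.comp Computable.fst)) Computable.snd))

theorem computable_pending : Computable₂ A.pending := by
  refine Computable.list_any Computable.snd ?_
  refine Primrec.and.to_comp.comp (Primrec.eq.decide.to_comp.comp
    (Computable.fst.comp (Computable.fst.comp (Computable.fst.comp Computable.snd)))
    (Computable.fst.comp Computable.fst)) ?_
  refine (Computable.option_casesOn (A.computable_out.comp (Computable.snd.comp Computable.snd))
    (Computable.const true) (Computable.const false).to₂).of_eq fun p => ?_
  cases A.out p.2.2 <;> rfl

theorem computable_pendingSnapshots {w : α → ℤ} {R : α → List NodeRecord} {k : α → ℕ}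
    (hw : Computable w) (hR : Computable R) (hk : Computable k) :
    Computable fun a => A.pendingSnapshots (w a) (R a) (k a) := by
  refine (Computable.nat_rec (h := fun a (p : ℕ × List (List (NodeRecord × ℕ))) =>
    (p.2.flatMap A.nextSnapshots).filter (A.pending (w a))) hk
    (g := fun a => (A.initSnapshots (R a)).filter (A.pending (w a))) ?_ ?_).of_eq fun a => ?_
  · exact Computable.list_filter (A.computable_initSnapshots.comp hR)
      (A.computable_pending.comp (hw.comp Computable.fst) Computable.snd)
  · exact Computable.list_filter (Computable.list_flatMap (Computable.snd.comp Computable.snd)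
      (A.computable_nextSnapshots.comp Computable.snd))
      (A.computable_pending.comp (hw.comp (Computable.fst.comp Computable.fst)) Computable.snd)
  · induction k a with
    | zero => rfl
    | succ n ih => rw [pendingSnapshots, ← ih]

theorem computable_settled {w : α → ℤ} {R : α → List NodeRecord} {k : α → ℕ}
    (hw : Computable w) (hR : Computable R) (hk : Computable k) :
    Computable fun a => A.settled (w a) (R a) (k a) := by
  refine Computable.list_all (Computable.list_sublists' hR) ?_
  refine Primrec.or.to_comp.comp (Primrec.not.to_comp.comp (Computable.list_any Computable.snd
    (Primrec.eq.decide.to_comp.comp (Computable.fst.comp (Computable.fst.comp Computable.snd))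
      (hw.comp (Computable.fst.comp Computable.fst))))) ?_
  refine (Primrec.eq.decide.to_comp.comp (Computable.list_length.comp
    (A.computable_pendingSnapshots (hw.comp Computable.fst) Computable.snd
      (hk.comp Computable.fst))) (Computable.const 0)).of_eq fun p => ?_
  cases A.pendingSnapshots (w p.1) p.2 (k p.1) <;> rfl

theorem computable_verdict {f : List (List Bool) × List (List Bool) → Bool} (hf : Computable f)
    (C : ℕ) : Computable (verdict A f C) := by
  have hR : Computable fun s : CollectorState => sortRecords s.2 :=
    computable_sortRecords.comp Computable.snd
  refine Computable.cond (A.computable_settled (Computable.fst.comp (Computable.fst.comp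
    Computable.fst)) hR ?_) ?_ (Computable.const none)
  · exact Primrec.nat_div.to_comp.comp (Computable.snd.comp Computable.fst) (Computable.const C)
  · exact Computable.option_some.comp (hf.comp (computable_recordCode.comp hR))

end LocalAlgorithm

end Computability

/-- The deterministic algorithm that collects a part of the graph on which the randomized
algorithm `A` can be simulated, and then decides whether this part belongs to the language. -/
def collector (A : LocalAlgorithm) {f : List (List Bool) × List (List Bool) → Bool}
    (hf : Computable f) (C : ℕ) : LocalAlgorithm where
  initCoins _ := 0
  init p := Encodable.encode (((p.1, 0), [(p.1, [])]) : CollectorState)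
  send s := s
  stepCoins _ := 0
  step p := Encodable.encode (collect (decodeCollector p.1.1) p.1.2)
  out s := verdict A f C (decodeCollector s)
  computable_initCoins := Computable.const 0
  computable_init := Computable.encode.comp (Computable.pair
    (Computable.pair Computable.fst (Computable.const 0))
    (Computable.list_cons.comp (Computable.pair Computable.fst (Computable.const []))
      (Computable.const [])))
  computable_send := Computable.id
  computable_stepCoins := Computable.const 0
  computable_step := Computable.encode.comp (computable_collect.comp
    (computable_decodeCollector.comp (Computable.fst.comp Computable.fst))
    (Computable.snd.comp Computable.fst))
  computable_out := (A.computable_verdict hf C).comp computable_decodeCollector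

theorem LocalAlgorithm.mem_inbox (A : LocalAlgorithm) (I : IdConfig) (s : Fin I.n → ℕ)
    (v : Fin I.n) (m : ℤ × ℕ) :
    m ∈ A.inbox I s v ↔ ∃ u, I.graph.Adj v u ∧ m = (I.ident u, A.send (s u)) := by
  simp [LocalAlgorithm.inbox, eq_comm]

/-! ### Knowledge and output of a collecting node -/

section Collector

variable {A : LocalAlgorithm} {f : List (List Bool) × List (List Bool) → Bool}
  {hf : Computable f} {C : ℕ} {I : IdConfig}

/-- What a node knows after every round. -/
theorem exists_records_collector (ω : CoinSpace I.n) :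
    ∃ nb : Fin I.n → List ℤ, (∀ u v, I.ident u ∈ nb v ↔ I.graph.Adj v u) ∧
      ∀ r v, ∃ R : List NodeRecord,
        decodeCollector ((collector A hf C).state I ω (r + 1) v) =
          (((I.ident v, I.input v), r + 1), R) ∧
        ∀ x, x ∈ R ↔ ∃ u ∈ I.ball Set.univ v r, x = ((I.ident u, I.input u), nb u) := by
  set B := collector A hf C
  have hstep : ∀ r v, decodeCollector (B.state I ω (r + 1) v) =
      collect (decodeCollector (B.state I ω r v)) (B.inbox I (B.state I ω r) v) :=
    fun r v => decodeCollector_encode _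
  refine ⟨fun v => (B.inbox I (B.state I ω 0) v).map Prod.fst, fun u v => ?_, fun r => ?_⟩
  · simp only [List.mem_map, B.mem_inbox]
    constructor
    · rintro ⟨_, ⟨x, hx, rfl⟩, h⟩
      rwa [← I.ident_injective h]
    · exact fun h => ⟨_, ⟨u, h, rfl⟩, rfl⟩
  · induction r with
    | zero =>
      intro v
      have h0 : decodeCollector (B.state I ω 0 v) =
          (((I.ident v, I.input v), 0), [((I.ident v, I.input v), [])]) :=
        decodeCollector_encode _
      refine ⟨_, by rw [hstep, h0]; rfl, fun x => ?_⟩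
      simp [IdConfig.ball]
    | succ r ih =>
      intro v
      obtain ⟨R, hv, hR⟩ := ih v
      refine ⟨_, by rw [hstep, hv]; rfl, fun x => ?_⟩
      rw [show decide (((((I.ident v, I.input v), r + 1), R) : CollectorState).1.2 = 0) = false
        from rfl, cond_false, List.mem_append, hR, List.mem_flatMap]
      simp only [IdConfig.mem_ball_univ_succ, or_and_right, exists_or]
      refine or_congr_right ⟨?_, ?_⟩
      · rintro ⟨m, hm, hx⟩
        obtain ⟨y, hy, rfl⟩ := (B.mem_inbox I _ _ _).1 hm
        obtain ⟨R', hy', hR'⟩ := ih y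
        change x ∈ (decodeCollector (B.state I ω (r + 1) y)).2 at hx
        rw [hy', hR'] at hx
        obtain ⟨u, hu, hx⟩ := hx
        exact ⟨u, ⟨y, hy, hu⟩, hx⟩
      · rintro ⟨u, ⟨y, hy, hu⟩, hx⟩
        obtain ⟨R', hy', hR'⟩ := ih y
        refine ⟨_, (B.mem_inbox I _ _ _).2 ⟨y, hy, rfl⟩, ?_⟩
        change x ∈ (decodeCollector (B.state I ω (r + 1) y)).2
        rw [hy', hR']
        exact ⟨u, hu, hx⟩

/-- The output of a node after `r` rounds. -/
theorem out_collector {L : DistributedLanguage} (hfL : ∀ c : Config, f c.code = true ↔ c ∈ L.carrier)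
    (ω : CoinSpace I.n) (r : ℕ) (v : Fin I.n) :
    (((collector A hf C).out ((collector A hf C).state I ω r v)).isSome ↔
      ∀ U ⊆ I.ball Set.univ v (r - 1), v ∈ U → ∀ ω' : CoinSpace I.n,
        ∃ s ≤ r / C, (A.out (A.stateOn I U ω' s v)).isSome) ∧
    ∀ b, (collector A hf C).out ((collector A hf C).state I ω r v) = some b →
      (b = true ↔ I.Accepts L (I.ball Set.univ v (r - 1))) := by
  -- One round is spent on learning the neighbours' identities, hence radius `r - 1`. For `r = 0`
  -- truncated subtraction gives the ball `{v}`, for which the empty neighbour list is correct.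
  have key : ∃ nb : Fin I.n → List ℤ, (∀ u ∈ I.ball Set.univ v (r - 1),
      ∀ x ∈ I.ball Set.univ v (r - 1), I.ident u ∈ nb x ↔ I.graph.Adj x u) ∧
      ∃ R, decodeCollector ((collector A hf C).state I ω r v) =
        (((I.ident v, I.input v), r), R) ∧
        ∀ x, x ∈ R ↔ ∃ u ∈ I.ball Set.univ v (r - 1), x = ((I.ident u, I.input u), nb u) := by
    cases r with
    | zero =>
      refine ⟨fun _ => [], ?_, [((I.ident v, I.input v), [])], decodeCollector_encode _, ?_⟩
      · intro u hu x hx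
        rw [Set.mem_singleton_iff.1 hu, Set.mem_singleton_iff.1 hx]
        simp
      · simp [IdConfig.ball]
    | succ r =>
      obtain ⟨nb, hnb, h⟩ := exists_records_collector (A := A) (hf := hf) (C := C) ω
      exact ⟨nb, fun u _ x _ => hnb u x, h r v⟩
  obtain ⟨nb, hnb, R, hdec, hR⟩ := key
  have hsort := sortRecords_eq hR
  have hout : (collector A hf C).out ((collector A hf C).state I ω r v) =
      verdict A f C (((I.ident v, I.input v), r), R) := by
    rw [← hdec]; rfl
  rw [hout, verdict, ← A.settled_iff hnb]
  simp only [hsort]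
  constructor
  · cases A.settled (I.ident v) _ (r / C) <;> simp
  · intro b hb
    have hb' : f (recordCode ((I.nodesIn (I.ball Set.univ v (r - 1))).map fun u =>
        ((I.ident u, I.input u), nb u))) = b := by
      revert hb
      cases A.settled (I.ident v) _ (r / C) <;> simp
    rw [recordCode_eq hnb IdConfig.conn_ball] at hb'
    rw [← hb', hfL]
    exact ⟨fun h => ⟨_, h⟩, fun h => h.2⟩

end Collector


open MeasureTheory ProbabilityTheory

instance (n : ℕ) : IsProbabilityMeasure (coinMeasure n) := by
  unfold coinMeasure; infer_instance

/-! ### Measurability -/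

theorem measurable_coins {n : ℕ} (v : Fin n) (r k : ℕ) (g : List Bool → ℕ) :
    Measurable fun ω : CoinSpace n => g (coins ω v r k) := by
  have h : Measurable fun (ω : CoinSpace n) (i : Fin k) => ω (v, r, i) :=
    measurable_pi_lambda _ fun i => measurable_pi_apply _
  exact (measurable_of_finite fun c : Fin k → Bool => g (List.ofFn c)).comp h

/-- The number of bits read is itself random; it becomes constant on each of the countably many
events that fix the states. -/
theorem measurable_coins_of_state {n m : ℕ} {s : CoinSpace n → Fin m → ℕ} (hs : Measurable s)
    (v : Fin n) (r : ℕ) (K : (Fin m → ℕ) → ℕ) (g : (Fin m → ℕ) → List Bool → ℕ) :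
    Measurable fun ω : CoinSpace n => g (s ω) (coins ω v r (K (s ω))) := by
  refine measurable_to_countable' fun y => ?_
  have : (fun ω : CoinSpace n => g (s ω) (coins ω v r (K (s ω)))) ⁻¹' {y} =
      ⋃ a : Fin m → ℕ, (s ⁻¹' {a}) ∩ ((fun ω => g a (coins ω v r (K a))) ⁻¹' {y}) := by
    ext ω
    simp
  rw [this]
  exact MeasurableSet.iUnion fun a => (hs (measurableSet_singleton a)).inter
    (measurable_coins v r (K a) (g a) (measurableSet_singleton y))

theorem measurableSet_first_output {Ω : Type*} [MeasurableSpace Ω] {s : ℕ → Ω → ℕ}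
    (hs : ∀ r, Measurable (s r)) (out : ℕ → Option Bool) (b : Bool) :
    MeasurableSet {ω | ∃ r, out (s r ω) = some b ∧ ∀ j < r, out (s j ω) = none} := by
  have h : ∀ r o, MeasurableSet {ω | out (s r ω) = o} := fun r o =>
    hs r (MeasurableSet.of_discrete (s := {x | out x = o}))
  simp only [Set.ofPred_exists, Set.ofPred_and, Set.ofPred_forall]
  exact MeasurableSet.iUnion fun r => (h r _).inter
    (MeasurableSet.iInter fun j => MeasurableSet.iInter fun _ => h j _)

namespace LocalAlgorithm

variable (A : LocalAlgorithm) (I : IdConfig)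

theorem measurable_state (r : ℕ) : Measurable fun ω : CoinSpace I.n => A.state I ω r := by
  induction r with
  | zero => exact measurable_pi_lambda _ fun v => measurable_coins v 0 _ fun c =>
      A.init ((I.ident v, I.input v), c)
  | succ r ih =>
    exact measurable_pi_lambda _ fun v => measurable_coins_of_state ih v (r + 1)
      (fun s => A.stepCoins (s v, A.inbox I s v)) fun s c => A.step ((s v, A.inbox I s v), c)

theorem measurable_stateOn (S : Set (Fin I.n)) (r : ℕ) :
    Measurable fun ω : CoinSpace I.n => A.stateOn I S ω r := by
  induction r with
  | zero => exact measurable_pi_lambda _ fun v => measurable_coins v 0 _ fun c =>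
      A.init ((I.ident v, I.input v), c)
  | succ r ih =>
    exact measurable_pi_lambda _ fun v => measurable_coins_of_state ih v (r + 1)
      (fun s => A.stepCoins (s v, A.inboxOn I S s v)) fun s c => A.step ((s v, A.inboxOn I S s v), c)

theorem measurableSet_outputs (v : Fin I.n) (b : Bool) :
    MeasurableSet {ω | A.Outputs I ω v b} :=
  measurableSet_first_output (s := fun r ω => A.state I ω r v)
    (fun r => (measurable_pi_apply v).comp (A.measurable_state I r)) A.out b

theorem measurableSet_outputsOn (S : Set (Fin I.n)) (v : Fin I.n) (b : Bool) :
    MeasurableSet {ω | A.OutputsOn I S ω v b} :=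
  measurableSet_first_output (s := fun r ω => A.stateOn I S ω r v)
    (fun r => (measurable_pi_apply v).comp (A.measurable_stateOn I S r)) A.out b

end LocalAlgorithm

/-! ### Independence -/

theorem measure_inter_of_dependsOn {ι : Type*} (μ : ι → Measure Bool)
    [∀ i, IsProbabilityMeasure (μ i)] {E F : Set (ι → Bool)} (hE : MeasurableSet E)
    (hF : MeasurableSet F) {s t : Set ι} (hst : Disjoint s t)
    (hEs : ∀ ω ω', (∀ i ∈ s, ω i = ω' i) → ω ∈ E → ω' ∈ E)
    (hFt : ∀ ω ω', (∀ i ∈ t, ω i = ω' i) → ω ∈ F → ω' ∈ F) :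
    Measure.infinitePi μ (E ∩ F) = Measure.infinitePi μ E * Measure.infinitePi μ F := by
  classical
  have hind : iIndepFun (fun (i : ι) (ω : ι → Bool) => ω i) (Measure.infinitePi μ) :=
    iIndepFun_infinitePi (X := fun _ x => x) fun _ => measurable_id
  have key : ∀ (s : Set ι) (E : Set (ι → Bool)), MeasurableSet E →
      (∀ ω ω', (∀ i ∈ s, ω i = ω' i) → ω ∈ E → ω' ∈ E) →
      MeasurableSet[⨆ i ∈ s, MeasurableSpace.comap (fun ω : ι → Bool => ω i) inferInstance] E := by
    intro s E hE hs
    -- `g` erases the coordinates outside `s`. It is measurable for the σ-algebra generated by `s`,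
    -- and `E` is its own preimage under `g`.
    let g : (ι → Bool) → ι → Bool := fun ω i => if i ∈ s then ω i else false
    have hg : Measurable[⨆ i ∈ s,
        MeasurableSpace.comap (fun ω : ι → Bool => ω i) inferInstance] g := by
      refine @measurable_pi_lambda _ _ _ (_) _ _ fun i => ?_
      by_cases hi : i ∈ s
      · simp only [g, hi, if_true]
        exact (comap_measurable _).mono (le_iSup₂_of_le i hi le_rfl) le_rfl
      · simp only [g, hi, if_false]
        exact @measurable_const _ _ _ (_) _
    have hEg : E = g ⁻¹' E := by
      ext ω
      exact ⟨hs _ _ fun i hi => by simp [g, hi], hs _ _ fun i hi => by simp [g, hi]⟩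
    rw [hEg]
    exact hg hE
  exact (Indep_iff _ _ _).1
    (indep_iSup_of_disjoint (fun i => (measurable_pi_apply i).comap_le) hind hst) E F
    (key s E hE hEs) (key t F hF hFt)

/-- Events that depend on the coins of disjoint sets of nodes are independent. -/
theorem coinMeasure_inter {n : ℕ} {E F : Set (CoinSpace n)} (hE : MeasurableSet E)
    (hF : MeasurableSet F) {s t : Set (Fin n)} (hst : Disjoint s t)
    (hEs : ∀ ω ω' : CoinSpace n, (∀ v ∈ s, ∀ j, ω (v, j) = ω' (v, j)) → ω ∈ E → ω' ∈ E)
    (hFt : ∀ ω ω' : CoinSpace n, (∀ v ∈ t, ∀ j, ω (v, j) = ω' (v, j)) → ω ∈ F → ω' ∈ F) :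
    (coinMeasure n).real (E ∩ F) = (coinMeasure n).real E * (coinMeasure n).real F := by
  rw [measureReal_def, measureReal_def, measureReal_def, ← ENNReal.toReal_mul]
  congr 1
  exact measure_inter_of_dependsOn _ hE hF (hst.preimage Prod.fst)
    (fun ω ω' h => hEs ω ω' fun v hv j => h (v, j) hv)
    (fun ω ω' h => hFt ω ω' fun v hv j => h (v, j) hv)

/-! ### The executions on connected induced subgraphs -/

/-- Selecting coordinates along an injection maps a product measure to the product measure. -/
theorem coinMeasure_restrict (I : IdConfig) (S : Set (Fin I.n)) (h : I.Conn S)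
    {E : Set (CoinSpace (I.restrict S h).n)} (hE : MeasurableSet E) :
    coinMeasure (I.restrict S h).n E = coinMeasure I.n (I.restrictCoins S h ⁻¹' E) := by
  have hinj : Function.Injective fun x : Fin (I.restrict S h).n × ℕ × ℕ =>
      (I.restrictEmb S h x.1, x.2) := fun x y hxy =>
    Prod.ext ((I.restrictEmb S h).injective (congrArg Prod.fst hxy)) (congrArg Prod.snd hxy :)
  have hmap := Measure.map_infinitePi_infinitePi_of_inj
    (P := fun _ : Fin I.n × ℕ × ℕ => (PMF.uniformOfFintype Bool).toMeasure) hinj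
  rw [coinMeasure, ← hmap, Measure.map_apply (measurable_pi_lambda _ fun i => measurable_pi_apply _) hE]
  rfl

namespace LocalAlgorithm

variable (A : LocalAlgorithm) (I : IdConfig)

/-- In the execution on the subgraph induced by `S`, all nodes of `X` output "yes". -/
def allYes (S X : Set (Fin I.n)) : Set (CoinSpace I.n) :=
  {ω | ∀ v ∈ X, A.OutputsOn I S ω v true}

theorem measurableSet_allYes (S X : Set (Fin I.n)) : MeasurableSet (A.allYes I S X) := by
  simp only [allYes, Set.ofPred_forall]
  exact MeasurableSet.iInter fun v => MeasurableSet.iInter fun _ =>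
    A.measurableSet_outputsOn I S v true

variable {A} {L : DistributedLanguage} {p q : ℝ}

theorem IsDecider.le_allYes (hA : A.IsDecider p q L) {S : Set (Fin I.n)}
    (hS : I.Accepts L S) : p ≤ (coinMeasure I.n).real (A.allYes I S S) := by
  obtain ⟨h, hm⟩ := hS
  have := (hA (I.restrict S h)).1 hm
  have hE : MeasurableSet {ω | ∀ v, A.Outputs (I.restrict S h) ω v true} := by
    simp only [Set.ofPred_forall]
    exact MeasurableSet.iInter fun v => A.measurableSet_outputs _ v true
  rw [coinMeasure_restrict I S h hE, ENNReal.ofReal_le_iff_le_toReal (measure_ne_top _ _)] at this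
  refine this.trans (measureReal_mono fun ω hω v hv => ?_)
  obtain ⟨i, rfl⟩ := I.exists_restrictEmb h hv
  exact (A.outputs_restrict I S h ω i true).1 (hω i)

theorem IsDecider.le_exists_no (hA : A.IsDecider p q L) {S : Set (Fin I.n)} (h : I.Conn S)
    (hS : ¬ I.Accepts L S) :
    q ≤ (coinMeasure I.n).real {ω | ∃ v ∈ S, A.OutputsOn I S ω v false} := by
  have := (hA (I.restrict S h)).2 fun hm => hS ⟨h, hm⟩
  have hE : MeasurableSet {ω | ∃ v, A.Outputs (I.restrict S h) ω v false} := by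
    simp only [Set.ofPred_exists]
    exact MeasurableSet.iUnion fun v => A.measurableSet_outputs _ v false
  rw [coinMeasure_restrict I S h hE, ENNReal.ofReal_le_iff_le_toReal (measure_ne_top _ _)] at this
  refine this.trans (measureReal_mono ?_)
  rintro ω ⟨i, hi⟩
  exact ⟨_, I.restrictEmb_mem S h i, (A.outputs_restrict I S h ω i false).1 hi⟩

theorem IsDecider.allYes_le (hA : A.IsDecider p q L) {S : Set (Fin I.n)} (h : I.Conn S)
    (hS : ¬ I.Accepts L S) : (coinMeasure I.n).real (A.allYes I S S) ≤ 1 - q := by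
  have hno := hA.le_exists_no I h hS
  have hdisj : {ω | ∃ v ∈ S, A.OutputsOn I S ω v false} ⊆ (A.allYes I S S)ᶜ := by
    rintro ω ⟨v, hv, hf⟩ hall
    exact absurd (A.outputsOn_unique I hf (hall v hv)) (by simp)
  have hle := measureReal_mono (μ := coinMeasure I.n) hdisj
  rw [probReal_compl_eq_one_sub (A.measurableSet_allYes I S S)] at hle
  linarith

end LocalAlgorithm

/-! ### Locality, the slicing argument and the minimal counterexample -/

open MeasureTheory

namespace LocalAlgorithm

variable {A : LocalAlgorithm} {I : IdConfig}

theorem stateOn_eq_of_ball_subset {S S' : Set (Fin I.n)} {w : Fin I.n} {R : ℕ}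
    (hS' : S' ⊆ S) (hb : I.ball S w R ⊆ S') {ω ω' : CoinSpace I.n}
    (hω : ∀ x ∈ I.ball S w R, ∀ j, ω (x, j) = ω' (x, j)) {r : ℕ} (hr : r ≤ R) :
    A.stateOn I S ω r w = A.stateOn I S' ω' r w := by
  -- The dependence cone: the state of `w` after `R` rounds involves states after `j` rounds only
  -- within distance `R - j`.
  refine A.stateOn_congr I (fun j => {u | j ≤ R ∧ u ∈ I.ball S w (R - j)}) ?_ ?_ r w
    ⟨hr, IdConfig.self_mem_ball⟩
  · rintro j u ⟨hj, hu⟩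
    have hR : R - (j + 1) + 1 = R - j := by omega
    have hle := IdConfig.ball_mono_radius (I := I) (S := S) (w := w) (Nat.sub_le R j)
    refine ⟨⟨by omega, IdConfig.ball_mono_radius (by omega) hu⟩, fun x hux => ?_⟩
    have hx : x ∈ S → x ∈ I.ball S w (R - j) := fun hx => hR ▸ IdConfig.mem_ball_succ hx hu hux
    exact ⟨⟨fun h => hb (hle (hx h)), fun h => hS' h⟩, fun h => ⟨by omega, hx h⟩⟩
  · rintro j u ⟨-, hu⟩ i
    exact hω u (IdConfig.ball_mono_radius (Nat.sub_le R j) hu) _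

theorem outputsOn_iff_of_ball_subset {S S' : Set (Fin I.n)} {w : Fin I.n} {T : ℕ}
    (hS' : S' ⊆ S) (hb : I.ball S w T ⊆ S') {ω ω' : CoinSpace I.n}
    (hω : ∀ x ∈ I.ball S w T, ∀ j, ω (x, j) = ω' (x, j))
    (hT : ∃ r ≤ T, (A.out (A.stateOn I S ω r w)).isSome) (b : Bool) :
    A.OutputsOn I S ω w b ↔ A.OutputsOn I S' ω' w b :=
  A.outputsOn_iff_of_agree I hT (fun _ hr => stateOn_eq_of_ball_subset hS' hb hω hr) b

variable {S : Set (Fin I.n)} {T : ℕ}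

theorem allYes_inter (X Y : Set (Fin I.n)) :
    A.allYes I S X ∩ A.allYes I S Y = A.allYes I S (X ∪ Y) := by
  ext ω
  exact ⟨fun h v hv => hv.elim (h.1 v) (h.2 v),
    fun h => ⟨fun v hv => h v (Or.inl hv), fun v hv => h v (Or.inr hv)⟩⟩

/-- The outputs of distant sets of nodes are independent. -/
theorem allYes_indep (h : I.Conn S) {v : Fin I.n} (hv : v ∈ S)
    (hT : ∀ ω, ∀ u ∈ S, ∃ r ≤ T, (A.out (A.stateOn I S ω r u)).isSome)
    {X Y : Set (Fin I.n)} (hX : X ⊆ S) (hY : Y ⊆ S)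
    (hXY : ∀ x ∈ X, ∀ y ∈ Y, I.distIn S v x + 2 * T < I.distIn S v y) :
    (coinMeasure I.n).real (A.allYes I S (X ∪ Y)) =
      (coinMeasure I.n).real (A.allYes I S X) * (coinMeasure I.n).real (A.allYes I S Y) := by
  have dep : ∀ X ⊆ S, ∀ ω ω' : CoinSpace I.n,
      (∀ u ∈ {u | ∃ x ∈ X, u ∈ I.ball S x T}, ∀ j, ω (u, j) = ω' (u, j)) →
      ω ∈ A.allYes I S X → ω' ∈ A.allYes I S X := by
    intro X hX ω ω' hω hall x hx
    exact (outputsOn_iff_of_ball_subset subset_rfl (IdConfig.ball_subset (hX hx))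
      (fun u hu => hω u ⟨x, hx, hu⟩) (hT ω x (hX hx)) true).1 (hall x hx)
  rw [← allYes_inter]
  refine coinMeasure_inter (A.measurableSet_allYes I S X) (A.measurableSet_allYes I S Y)
    (Set.disjoint_left.2 ?_) (dep X hX) (dep Y hY)
  -- A coin relevant to both `x` and `y` would put them within distance `2 * T` of each other.
  rintro u ⟨x, hx, hux⟩ ⟨y, hy, huy⟩
  have hyx : y ∈ I.ball S x (T + T) :=
    IdConfig.mem_ball_trans hux (IdConfig.mem_ball_symm (hY hy) huy)
  have := (h.mem_ball_iff hv (hY hy)).1 (IdConfig.mem_ball_trans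
    ((h.mem_ball_iff hv (hX hx)).2 le_rfl) hyx)
  have := hXY x hx y hy
  omega

/-- If the subgraph induced by `S` is the union of two accepted parts with a wide overlap, then it
is likely that all its nodes output "yes". -/
theorem IsDecider.sq_sub_le_allYes {p q δ : ℝ} {L : DistributedLanguage} (hA : A.IsDecider p q L)
    (hp : 0 ≤ p) {κ : ℕ} (hκ : (1 - δ) ^ κ < p)
    (h : I.Conn S) {v : Fin I.n} (hv : v ∈ S)
    (hT : ∀ ω, ∀ u ∈ S, ∃ r ≤ T, (A.out (A.stateOn I S ω r u)).isSome)
    (hrest : I.Accepts L (S \ {v})) (hball : I.Accepts L (I.ball S v (4 * κ * T))) :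
    p ^ 2 - δ ≤ (coinMeasure I.n).real (A.allYes I S S) := by
  set d := I.distIn S v with hd
  -- In `T` rounds such nodes cannot notice whether `v` is present, so they behave as in `S \ {v}`.
  have far : ∀ X ⊆ S, (∀ u ∈ X, T < d u) → p ≤ (coinMeasure I.n).real (A.allYes I S X) := by
    intro X hX hfar
    refine (hA.le_allYes I hrest).trans (measureReal_mono fun ω hω u hu => ?_)
    have huv : u ≠ v := by
      rintro rfl
      have := hfar u hu
      rw [hd, IdConfig.distIn_self] at this
      omega
    refine (outputsOn_iff_of_ball_subset Set.sdiff_subset ?_ (fun _ _ _ => rfl)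
      (hT ω u (hX hu)) true).2 (hω u ⟨hX hu, huv⟩)
    intro x hx
    refine ⟨IdConfig.ball_subset (hX hu) hx, ?_⟩
    rintro rfl
    have := (h.mem_ball_iff hv (hX hu)).1 (IdConfig.mem_ball_symm (hX hu) hx)
    exact absurd (hfar u hu) this.not_gt
  -- These nodes lie so deep inside the ball around `v` that they behave as in it.
  have near : ∀ X ⊆ S, (∀ u ∈ X, d u + T ≤ 4 * κ * T) →
      p ≤ (coinMeasure I.n).real (A.allYes I S X) := by
    intro X hX hnear
    refine (hA.le_allYes I hball).trans (measureReal_mono fun ω hω u hu => ?_)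
    have hub : ∀ j, d u + j ≤ 4 * κ * T → I.ball S u j ⊆ I.ball S v (4 * κ * T) := fun j hj x hx =>
      IdConfig.ball_mono_radius hj
        (IdConfig.mem_ball_trans ((h.mem_ball_iff hv (hX hu)).2 le_rfl) hx)
    exact (outputsOn_iff_of_ball_subset (IdConfig.ball_subset hv) (hub T (hnear u hu))
      (fun _ _ _ => rfl) (hT ω u (hX hu)) true).2
      (hω u (hub T (hnear u hu) IdConfig.self_mem_ball))
  -- Period `4 * T`: width `2 * T` to separate the two sides, then a gap of `2 * T` to make the
  -- slices independent. The offset `T + 1` puts every slice in the scope of `far`.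
  let slice : ℕ → Set (Fin I.n) := fun i =>
    {u | u ∈ S ∧ T + 1 + 4 * T * i ≤ d u ∧ d u < T + 1 + 4 * T * i + 2 * T}
  let slices : ℕ → Set (Fin I.n) := fun i => {u | ∃ j < i, u ∈ slice j}
  have slices_sub : ∀ i, slices i ⊆ S := by
    rintro i u ⟨_, _, hu⟩
    exact hu.1
  have hprod : ∀ i, (coinMeasure I.n).real (A.allYes I S (slices i)) =
      ∏ j ∈ Finset.range i, (coinMeasure I.n).real (A.allYes I S (slice j)) := by
    intro i
    induction i with
    | zero =>
      have : A.allYes I S (slices 0) = Set.univ := by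
        refine Set.eq_univ_of_forall fun ω u hu => ?_
        obtain ⟨j, hj, -⟩ := hu
        exact absurd hj (Nat.not_lt_zero j)
      simp [this]
    | succ i ih =>
      have : slices (i + 1) = slices i ∪ slice i := by
        ext u
        constructor
        · rintro ⟨j, hj, hu⟩
          rcases Nat.lt_succ_iff_lt_or_eq.1 hj with hj | rfl
          · exact Or.inl ⟨j, hj, hu⟩
          · exact Or.inr hu
        · rintro (⟨j, hj, hu⟩ | hu)
          · exact ⟨j, hj.trans i.lt_succ_self, hu⟩
          · exact ⟨i, i.lt_succ_self, hu⟩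
      rw [Finset.prod_range_succ, ← ih, this]
      refine allYes_indep h hv hT (slices_sub i) (fun u hu => hu.1) ?_
      rintro x ⟨j, hj, -, -, hx⟩ y ⟨-, hy, -⟩
      have := Nat.mul_le_mul_left (4 * T) (Nat.succ_le_iff.2 hj)
      rw [Nat.mul_succ] at this
      change d x + 2 * T < d y
      omega
  obtain ⟨i, hi, hslice⟩ : ∃ i < κ, 1 - δ ≤ (coinMeasure I.n).real (A.allYes I S (slice i)) := by
    by_contra! hlt
    have hle : (coinMeasure I.n).real (A.allYes I S (slices κ)) ≤ (1 - δ) ^ κ := by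
      rw [hprod, ← Finset.card_range κ, ← Finset.prod_const, Finset.card_range]
      exact Finset.prod_le_prod (fun _ _ => measureReal_nonneg)
        fun j hj => (hlt j (Finset.mem_range.1 hj)).le
    have := far (slices κ) (slices_sub κ) fun u ⟨j, _, _, hu, _⟩ => by omega
    linarith
  let left : Set (Fin I.n) := {u | u ∈ S ∧ d u < T + 1 + 4 * T * i}
  let right : Set (Fin I.n) := {u | u ∈ S ∧ T + 1 + 4 * T * i + 2 * T ≤ d u}
  have hleft : p ≤ (coinMeasure I.n).real (A.allYes I S left) := by
    refine near left (fun u hu => hu.1) fun u hu => ?_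
    have h1 := Nat.mul_le_mul_left (4 * T) (Nat.succ_le_iff.2 hi)
    rw [Nat.mul_succ, show 4 * T * κ = 4 * κ * T by ring] at h1
    have := hu.2
    omega
  have hright : p ≤ (coinMeasure I.n).real (A.allYes I S right) :=
    far right (fun u hu => hu.1) fun u hu => by have := hu.2; omega
  have hlr := allYes_indep (X := left) (Y := right) h hv hT (fun u hu => hu.1) (fun u hu => hu.1)
    fun x hx y hy => by
      have := hx.2
      have := hy.2
      change d x + 2 * T < d y
      omega
  have hS : S = (left ∪ right) ∪ slice i := by
    ext u
    constructor
    · intro hu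
      by_cases h1 : d u < T + 1 + 4 * T * i
      · exact Or.inl (Or.inl ⟨hu, h1⟩)
      · by_cases h2 : T + 1 + 4 * T * i + 2 * T ≤ d u
        · exact Or.inl (Or.inr ⟨hu, h2⟩)
        · exact Or.inr ⟨hu, by omega, by omega⟩
    · rintro ((hu | hu) | hu) <;> exact hu.1
  -- The width of the slice makes `left` and `right` independent.
  have hpp : p ^ 2 ≤ (coinMeasure I.n).real (A.allYes I S (left ∪ right)) := by
    rw [hlr, sq]
    exact mul_le_mul hleft hright hp (hp.trans hleft)
  have hinter : (coinMeasure I.n).real (A.allYes I S (left ∪ right)) ≤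
      (coinMeasure I.n).real (A.allYes I S S) +
        (coinMeasure I.n).real (A.allYes I S (slice i))ᶜ := by
    conv_rhs => rw [show A.allYes I S S = A.allYes I S ((left ∪ right) ∪ slice i) by rw [← hS],
      ← allYes_inter]
    refine (measureReal_mono fun ω hω => ?_).trans (measureReal_union_le _ _)
    by_cases hs : ω ∈ A.allYes I S (slice i)
    · exact Or.inl ⟨hω, hs⟩
    · exact Or.inr hs
  rw [probReal_compl_eq_one_sub (A.measurableSet_allYes I S _)] at hinter
  linarith

/-- A configuration is accepted if every node lies in an accepted ball on which the randomized
algorithm is fast, compared to the radius. -/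
theorem IsDecider.accepts_of_forall_ball {p q : ℝ} {L : DistributedLanguage}
    (hA : A.IsDecider p q L) (hL : L.Hereditary) {t : IdConfig → ℝ} (ht : NonDecreasing t)
    (hrun : A.RunsInTime t) (hp : 0 < p) {δ : ℝ} (hpq : δ < p ^ 2 + q - 1)
    {κ : ℕ} (hκ : (1 - δ) ^ κ < p)
    (hloc : ∀ v, ∃ r, (∀ U ⊆ I.ball Set.univ v (r - 1), v ∈ U → ∀ ω : CoinSpace I.n,
        ∃ s ≤ r / (4 * κ + 2), (A.out (A.stateOn I U ω s v)).isSome) ∧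
      I.Accepts L (I.ball Set.univ v (r - 1))) :
    I.Accepts L Set.univ := by
  classical
  by_contra huniv
  -- Minimality makes every proper connected subset of `S` accepted.
  obtain ⟨S, ⟨hconn, hnot⟩, hmin⟩ := exists_minimal_of_wellFoundedLT
    (fun S : Set (Fin I.n) => I.Conn S ∧ ¬ I.Accepts L S) ⟨Set.univ, I.conn_univ, huniv⟩
  have hsmall : ∀ S' ⊆ S, S' ≠ S → I.Conn S' → I.Accepts L S' := by
    intro S' hsub hne hc
    by_contra hacc
    exact hne (hsub.antisymm (hmin ⟨hc, hacc⟩ hsub))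
  have hex : ∃ T, ∀ ω, ∀ u ∈ S, ∃ r ≤ T, (A.out (A.stateOn I S ω r u)).isSome :=
    ⟨⌊t I⌋₊, fun ω u hu => by
      obtain ⟨r, hr, ho⟩ := A.exists_out_stateOn I ht hrun hconn ω hu
      exact ⟨r, Nat.le_floor hr, ho⟩⟩
  obtain ⟨T, hT, hTmin⟩ : ∃ T, (∀ ω, ∀ u ∈ S, ∃ r ≤ T, (A.out (A.stateOn I S ω r u)).isSome) ∧
      ∀ k < T, ¬ ∀ ω, ∀ u ∈ S, ∃ r ≤ k, (A.out (A.stateOn I S ω r u)).isSome :=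
    ⟨Nat.find hex, Nat.find_spec hex, fun k hk => Nat.find_min hex hk⟩
  -- `w` is a slowest node: some execution on `S` keeps it undecided until round `T`.
  obtain ⟨w, hw, hwT⟩ : ∃ w ∈ S, ∀ k,
      (∀ ω, ∃ r ≤ k, (A.out (A.stateOn I S ω r w)).isSome) → T ≤ k := by
    by_contra! hlt
    obtain ⟨w₀, hw₀⟩ := hconn.nonempty
    obtain ⟨k₀, -, hk₀⟩ := hlt w₀ hw₀
    refine hTmin (T - 1) (by omega) fun ω u hu => ?_
    obtain ⟨k, hk, hkT⟩ := hlt u hu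
    obtain ⟨r, hr, ho⟩ := hk ω
    exact ⟨r, by omega, ho⟩
  obtain ⟨r, hfast, hacc⟩ := hloc w
  have hdiv : r / (4 * κ + 2) ≤ r - 1 := by
    have h1 : r / (4 * κ + 2) ≤ r / 2 := Nat.div_le_div_left (by omega) (by omega)
    omega
  -- Although `w` does not know `S`, its test covered the trace of `S` on its ball, where it behaves
  -- as on `S` for `r - 1` rounds.
  have hTr : T ≤ r / (4 * κ + 2) := by
    refine hwT _ fun ω => ?_
    obtain ⟨s, hs, ho⟩ := hfast (S ∩ I.ball Set.univ w (r - 1)) Set.inter_subset_right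
      ⟨hw, IdConfig.self_mem_ball⟩ ω
    refine ⟨s, hs, ?_⟩
    rwa [stateOn_eq_of_ball_subset (S' := S ∩ I.ball Set.univ w (r - 1)) Set.inter_subset_left
      (fun x hx => ⟨IdConfig.ball_subset hw hx, IdConfig.ball_mono (Set.subset_univ S) hx⟩)
      (fun _ _ _ => rfl) (hs.trans hdiv)]
  -- The summand `2` in the constant pays for the round lost in collecting.
  have hrad : 4 * κ * T ≤ r - 1 := by
    rcases Nat.eq_zero_or_pos T with h0 | h0
    · simp [h0]
    · have := (Nat.le_div_iff_mul_le (by omega)).1 hTr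
      have h2 : T * (4 * κ + 2) = 4 * κ * T + 2 * T := by ring
      omega
  have hwball : I.Accepts L (I.ball S w (4 * κ * T)) :=
    hacc.mono I hL ((IdConfig.ball_mono_radius hrad).trans
      (IdConfig.ball_mono (Set.subset_univ S))) IdConfig.conn_ball
  obtain ⟨u, hu, hub⟩ : ∃ u ∈ S, u ∉ I.ball S w (4 * κ * T) := by
    by_contra! hall
    exact hnot ((IdConfig.ball_subset hw).antisymm hall ▸ hwball)
  obtain ⟨v, hv, hmax⟩ := Set.exists_max_image S (I.distIn S w) S.toFinite ⟨w, hw⟩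
  have hwv : 4 * κ * T < I.distIn S w v := by
    refine lt_of_lt_of_le ?_ (hmax u hu)
    rw [hconn.mem_ball_iff hw hu] at hub
    exact not_le.1 hub
  have hne : w ≠ v := by
    rintro rfl
    rw [IdConfig.distIn_self] at hwv
    omega
  have hrest : I.Accepts L (S \ {v}) :=
    hsmall _ Set.sdiff_subset (fun h => (h.ge hv).2 rfl)
      (hconn.diff_singleton_of_farthest hw hne hmax)
  -- This ball is a proper subset of `S`, since it misses `w`.
  have hvball : I.Accepts L (I.ball S v (4 * κ * T)) := by
    refine hsmall _ (IdConfig.ball_subset hv) (fun h => ?_) IdConfig.conn_ball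
    have hwb : w ∈ I.ball S v (4 * κ * T) := h.symm ▸ hw
    exact absurd ((hconn.mem_ball_iff hw hv).1 (IdConfig.mem_ball_symm hv hwb)) hwv.not_ge
  have h1 := hA.sq_sub_le_allYes hp.le hκ hconn hv hT hrest hvball
  have h2 := hA.allYes_le I hconn hnot
  linarith

theorem exists_outputs (A : LocalAlgorithm) {I : IdConfig} {ω : CoinSpace I.n} {v : Fin I.n}
    {r : ℕ} (h : (A.out (A.state I ω r v)).isSome) :
    ∃ s b, A.out (A.state I ω s v) = some b ∧ A.Outputs I ω v b := by
  classical
  have hex : ∃ r, (A.out (A.state I ω r v)).isSome := ⟨r, h⟩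
  obtain ⟨b, hb⟩ := Option.isSome_iff_exists.1 (Nat.find_spec hex)
  exact ⟨_, b, hb, _, hb, fun s hs => by simpa using Nat.find_min hex hs⟩

end LocalAlgorithm

/-! ### Running time of the collecting algorithm and conclusion -/

theorem runsInTime_collector {A : LocalAlgorithm} {t : IdConfig → ℝ} (ht : NonDecreasing t)
    (hrun : A.RunsInTime t) {L : DistributedLanguage}
    {f : List (List Bool) × List (List Bool) → Bool} (hf : Computable f)
    (hfL : ∀ c : Config, f c.code = true ↔ c ∈ L.carrier) {C : ℕ} (hC : 0 < C) :
    (collector A hf C).RunsInTime fun I => C * t I := by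
  intro I ω v
  have ht0 : 0 ≤ t I := by
    obtain ⟨r, hr, -⟩ := hrun I (fun _ => false) v
    exact r.cast_nonneg.trans hr
  refine ⟨C * ⌊t I⌋₊, ?_, (out_collector hfL ω _ v).1.2 ?_⟩
  · push_cast
    exact mul_le_mul_of_nonneg_left (Nat.floor_le ht0) C.cast_nonneg
  · intro U _ hv ω'
    rw [Nat.mul_div_cancel_left _ hC]
    -- `U` may be disconnected, so the time bound is applied to the ball of `v` in `U`, outside of
    -- which `v` sees nothing in `⌊t I⌋₊` rounds.
    obtain ⟨s, hs, ho⟩ := A.exists_out_stateOn I ht hrun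
      (IdConfig.conn_ball (S := U) (w := v) (k := ⌊t I⌋₊)) ω' IdConfig.self_mem_ball
    refine ⟨s, Nat.le_floor hs, ?_⟩
    rwa [LocalAlgorithm.stateOn_eq_of_ball_subset (IdConfig.ball_subset hv) subset_rfl
      (fun _ _ _ => rfl) (Nat.le_floor hs)]

end LocalDecision

theorem theorem1 (L : LocalDecision.DistributedLanguage) (hL : L.Hereditary)
    (t : LocalDecision.IdConfig → ℝ) (ht : LocalDecision.NonDecreasing t)
    (p q : ℝ) (hp : p ∈ Set.Ioc (0 : ℝ) 1) (hq : q ∈ Set.Ioc (0 : ℝ) 1) (hpq : 1 < p ^ 2 + q)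
    (h : L ∈ LocalDecision.BPLD t p q) :
    L ∈ LocalDecision.LDBigO t := by
  open LocalDecision in
  obtain ⟨A, hrun, hA⟩ := h
  obtain ⟨f, hf, hfL⟩ := L.decidable
  -- `δ` is the probability lost at the separating slice, and must fit into the slack `p ^ 2 + q -
  -- 1`; `κ` is the number of slices that forces a good one.
  obtain ⟨δ, hδ0, hδ⟩ := exists_between (show 0 < p ^ 2 + q - 1 by linarith)
  obtain ⟨κ, hκ⟩ := exists_pow_lt_of_lt_one hp.1 (show 1 - δ < 1 by linarith)
  have hB := runsInTime_collector ht hrun hf hfL (C := 4 * κ + 2) (by omega)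
  refine ⟨((4 * κ + 2 : ℕ) : ℝ), by exact_mod_cast (by omega : 1 < 4 * κ + 2),
    collector A hf (4 * κ + 2), ⟨fun _ => rfl, fun _ => rfl⟩, hB, fun I ω => ⟨fun hI v => ?_,
      fun hI => ?_⟩⟩
  · obtain ⟨r, -, hr⟩ := hB I ω v
    obtain ⟨s, b, hs, hb⟩ := LocalAlgorithm.exists_outputs _ hr
    rwa [((out_collector hfL ω s v).2 b hs).2 (((I.accepts_univ hL).2 hI).mono I hL
      (Set.subset_univ _) IdConfig.conn_ball)] at hb
  · by_contra! hno
    refine hI ((I.accepts_univ hL).1 (hA.accepts_of_forall_ball hL ht hrun hp.1 hδ hκ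
      fun v => ?_))
    obtain ⟨r, -, hr⟩ := hB I ω v
    obtain ⟨s, b, hs, hb⟩ := LocalAlgorithm.exists_outputs _ hr
    have hbt : b = true := by
      cases b
      · exact absurd hb (hno v)
      · rfl
    exact ⟨s, (out_collector hfL ω s v).1.1 (by rw [hs]; rfl),
      ((out_collector hfL ω s v).2 b hs).1 hbt⟩
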